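/- Let $G(x,t)=\frac{1}{4\pi t}e^{-|x|^2/(4t)}$ be the Gauss kernel on $\mathbb R^2$, let $(e^{t\Delta}f)(x)=\int_{\mathbb R^2}G(x-y,t)f(y)\,dy$ be the heat semigroup (extended to real tempered distributions $T$ by $(e^{t\Delta}T)(x)=\langle T,G(x-\cdot,t)\rangle$), let $E_2(x)=\frac1{2\pi}\log|x|$, and write $\|\cdot\|_p$ for the norm of $L^p(\mathbb R^2)$. For $u,v\in L^{4/3}(\mathbb R^2)$ let $\nabla\phi_v=-(\nabla E_2)*v$ and $\mathcal B(u,v)=\nabla\cdot(u\nabla\phi_v)$, the divergence being taken in the sense of distributions. Let $$\|T\|_{B\mathcal X}=\sup_{t>0}t^{1/4}\|e^{t\Delta}T\|_{4/3},\qquad B\mathcal X=\{T\in\mathscr S'(\mathbb R^2):\ \|T\|_{B\mathcal X}<\infty\}.$$ For $u_0\in B\mathcal X$, a *global mild solution* of the Debye–Nernst–Planck system $u_t=\Delta u+\nabla\cdot(u\nabla\phi_u)$, $\phi_u=-E_2*u$, with initial datum $u_0$ is a measurable function $u:(0,\infty)\to L^{4/3}(\mathbb R^2)$ (real-valued) such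 that $$\sup_{t>0}\|u(t)\|_{B\mathcal X}<\infty,\qquad \sup_{t>0}t^{1/4}\|u(t)\|_{4/3}<\infty,$$ such that $\int_{\mathbb R^2}\psi(x)u(x,t)\,dx\to\langle u_0,\psi\rangle$ as $t\to0^+$ for every $\psi\in\mathscr S(\mathbb R^2)$, and such that for every $t>0$ $$u(t)=e^{t\Delta}u_0+\int_0^t e^{(t-\tau)\Delta}\,\mathcal B\big(u(\tau),u(\tau)\big)\,d\tau\qquad\text{a.e. on }\mathbb R^2 .$$ **Theorem.** There is $\varepsilon_0>0$ such that for every $\varepsilon\in(0,\varepsilon_0]$ the following holds. Let $u_0,v_0\in B\mathcal X$ with $\|u_0\|_{B\mathcal X}<\varepsilon$ and $\|v_0\|_{B\mathcal X}<\varepsilon$, and let $u,v$ be global mild solutions with initial data $u_0,v_0$, respectively, such that $\sup_{t>0}t^{1/4}\|u(t)\|_{4/3}\le2\varepsilon$ and $\sup_{t>0}t^{1/4}\|v(t)\|_{4/3}\le2\varepsilon$. Then $$\lim_{t\to\infty}t^{1/4}\big\|e^{t\Delta}(u_0-v_0)\big\|_{4/3}=0\quad\Longleftrightarrow\quad\lim_{t\to\infty}t^{1/4}\big\|u(t)-v(t)\big\|_{4/3}=0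 .$$ -/

import Mathlib

open Filter Topology MeasureTheory Set
open scoped ENNReal SchwartzMap ContDiff

namespace DebyeNernstPlanck

noncomputable section

/-- The plane `ℝ²` with its Euclidean structure and Lebesgue measure. -/
abbrev Plane : Type := EuclideanSpace ℝ (Fin 2)

/-- Real tempered distributions on the plane: the continuous dual of the real Schwartz space. -/
abbrev Tempered : Type := 𝓢(Plane, ℝ) →L[ℝ] ℝ

/-- The Gauss kernel `G(x,t) = (4πt)⁻¹ exp(-|x|²/(4t))`. -/
def heatKernel (t : ℝ) (x : Plane) : ℝ :=
  1 / (4 * Real.pi * t) * Real.exp (-(‖x‖ ^ 2 / (4 * t)))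

/-- The fundamental solution `E₂(x) = (2π)⁻¹ log |x|` of the Laplace equation. -/
def fundamentalSol (x : Plane) : ℝ := 1 / (2 * Real.pi) * Real.log ‖x‖

theorem heatKernel_exponent_temperate (t : ℝ) (x : Plane) :
    (fun y : Plane => -(‖x - y‖ ^ 2 / (4 * t))).HasTemperateGrowth := by
  have h1 : (fun y : Plane => x - y).HasTemperateGrowth := by fun_prop
  have h2 : (fun y : Plane => ‖x - y‖ ^ 2).HasTemperateGrowth :=
    (Function.hasTemperateGrowth_norm_sq (H := Plane)).comp h1
  have h3 := h2.mul (Function.HasTemperateGrowth.const (-(4 * t)⁻¹))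
  have h4 : (fun y : Plane => -(‖x - y‖ ^ 2 / (4 * t))) =
      (fun y : Plane => ‖x - y‖ ^ 2) * fun _ => -(4 * t)⁻¹ := by
    funext y
    simp only [Pi.mul_apply]
    rw [div_eq_mul_inv]; ring
  rw [h4]
  exact h3

theorem contDiff_heatKernel_sub (t : ℝ) (x : Plane) :
    ContDiff ℝ ∞ (fun y : Plane => heatKernel t (x - y)) := by
  unfold heatKernel
  exact contDiff_const.mul (Real.contDiff_exp.comp (heatKernel_exponent_temperate t x).1)

theorem heatKernel_sub_decay {t : ℝ} (ht : 0 < t) (x : Plane) (k n : ℕ) :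
    ∃ C : ℝ, ∀ y : Plane,
      ‖y‖ ^ k * ‖iteratedFDeriv ℝ n (fun y : Plane => heatKernel t (x - y)) y‖ ≤ C := by
  have hφ := heatKernel_exponent_temperate t x
  obtain ⟨N, K, hK, hb⟩ := hφ.norm_iteratedFDeriv_le_uniform n
  set φ : Plane → ℝ := fun y => -(‖x - y‖ ^ 2 / (4 * t)) with hφdef
  set c : ℝ := 1 / (4 * Real.pi * t) with hc
  have hform : (fun y : Plane => heatKernel t (x - y)) = c • (Real.exp ∘ φ) := by
    funext y; simp [heatKernel, hφdef, hc]
  have hcomp : ContDiff ℝ ∞ (Real.exp ∘ φ) := Real.contDiff_exp.comp hφ.1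
  set M : ℕ := k + N * n with hM
  refine ⟨|c| * (n.factorial * (K + 1) ^ n) * (M.factorial * Real.exp (1 + ‖x‖ + t)),
    fun y => ?_⟩
  have h1 : 1 ≤ 1 + ‖y‖ := by linarith [norm_nonneg y]
  have hD1 : 1 ≤ (K + 1) * (1 + ‖y‖) ^ N := by
    have := one_le_pow₀ (n := N) h1
    nlinarith
  have hexp : ‖iteratedFDeriv ℝ n (Real.exp ∘ φ) y‖
      ≤ n.factorial * Real.exp (φ y) * ((K + 1) * (1 + ‖y‖) ^ N) ^ n := by
    refine norm_iteratedFDeriv_comp_le (N := ∞) Real.contDiff_exp hφ.1 (by exact_mod_cast le_top)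
      y (fun i _ => ?_) (fun i hi hin => ?_)
    · rw [norm_iteratedFDeriv_eq_norm_iteratedDeriv, iteratedDeriv_eq_iterate,
        Real.iter_deriv_exp, Real.norm_of_nonneg (Real.exp_pos _).le]
    · refine (hb i hin y).trans ?_
      calc K * (1 + ‖y‖) ^ N ≤ (K + 1) * (1 + ‖y‖) ^ N := by gcongr; linarith
        _ ≤ ((K + 1) * (1 + ‖y‖) ^ N) ^ i := le_self_pow₀ hD1 (by omega)
  have hpoly : (1 + ‖y‖) ^ M * Real.exp (φ y) ≤ M.factorial * Real.exp (1 + ‖x‖ + t) := by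
    have hp := Real.pow_div_factorial_le_exp (1 + ‖y‖) (by linarith) M
    rw [div_le_iff₀ (by positivity)] at hp
    have htri : ‖y‖ ≤ ‖x‖ + ‖x - y‖ := by
      have := norm_sub_le x (x - y); simpa using this
    have hsq : ‖x - y‖ - ‖x - y‖ ^ 2 / (4 * t) ≤ t := by
      have : ‖x - y‖ ^ 2 / (4 * t) - ‖x - y‖ + t = (‖x - y‖ - 2 * t) ^ 2 / (4 * t) := by
        field_simp; ring
      have h0 : 0 ≤ (‖x - y‖ - 2 * t) ^ 2 / (4 * t) := by positivity
      linarith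
    calc (1 + ‖y‖) ^ M * Real.exp (φ y)
        ≤ (Real.exp (1 + ‖y‖) * M.factorial) * Real.exp (φ y) := by gcongr
      _ = M.factorial * Real.exp (1 + ‖y‖ + φ y) := by rw [Real.exp_add (1 + ‖y‖)]; ring
      _ ≤ M.factorial * Real.exp (1 + ‖x‖ + t) := by
        have : φ y = -(‖x - y‖ ^ 2 / (4 * t)) := rfl
        refine mul_le_mul_of_nonneg_left (Real.exp_le_exp.2 ?_) (by positivity)
        linarith
  rw [hform, iteratedFDeriv_const_smul_apply (hcomp.contDiffAt.of_le (by exact_mod_cast le_top)),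
    norm_smul, Real.norm_eq_abs]
  calc ‖y‖ ^ k * (|c| * ‖iteratedFDeriv ℝ n (Real.exp ∘ φ) y‖)
      ≤ (1 + ‖y‖) ^ k * (|c| * (n.factorial * Real.exp (φ y)
          * ((K + 1) * (1 + ‖y‖) ^ N) ^ n)) := by
        gcongr; linarith
    _ = |c| * (n.factorial * (K + 1) ^ n) * ((1 + ‖y‖) ^ M * Real.exp (φ y)) := by
        rw [hM, mul_pow, pow_add, pow_mul]; ring
    _ ≤ _ := by gcongr

/-- For `t > 0`, the Schwartz function `y ↦ G(x - y, t)`. -/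
def heatKernelSchwartz {t : ℝ} (ht : 0 < t) (x : Plane) : 𝓢(Plane, ℝ) where
  toFun y := heatKernel t (x - y)
  smooth' := contDiff_heatKernel_sub t x
  decay' k n := heatKernel_sub_decay ht x k n

open Classical in
/-- The heat semigroup on tempered distributions, `(e^{tΔ}T)(x) = ⟨T, G(x - ·, t)⟩` for `t > 0`
(only positive times are ever used). -/
def heat (t : ℝ) (T : Tempered) (x : Plane) : ℝ :=
  if ht : 0 < t then T (heatKernelSchwartz ht x) else 0

/-- The heat semigroup on functions, `(e^{tΔ}f)(x) = ∫ G(x - y, t) f(y) dy`. -/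
def heatFun (t : ℝ) (f : Plane → ℝ) (x : Plane) : ℝ :=
  ∫ y, heatKernel t (x - y) * f y

/-- The two forms of the heat semigroup agree on a distribution given by a function. -/
theorem heat_eq_heatFun {t : ℝ} (ht : 0 < t) (T : Tempered) (f : Plane → ℝ)
    (hT : ∀ ψ : 𝓢(Plane, ℝ), T ψ = ∫ y, ψ y * f y) : heat t T = heatFun t f := by
  funext x
  rw [heat, dif_pos ht, hT]
  rfl

/-- The norm of `L^{4/3}(ℝ²)`, with values in `[0, ∞]`. -/
def norm43 (f : Plane → ℝ) : ℝ≥0∞ := eLpNorm f (4 / 3) volume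

/-- `sup_{t > 0} t^{1/4} ‖F(t)‖_{4/3}` for a time-dependent function `F`. -/
def weightedSup (F : ℝ → Plane → ℝ) : ℝ≥0∞ :=
  ⨆ (t : ℝ) (_ : 0 < t), ENNReal.ofReal (t ^ (1 / 4 : ℝ)) * norm43 (F t)

/-- The norm `‖T‖_{BX} = sup_{t > 0} t^{1/4} ‖e^{tΔ}T‖_{4/3}` of a tempered distribution;
`T` belongs to `BX` when it is finite. -/
def besovNorm (T : Tempered) : ℝ≥0∞ := weightedSup fun t => heat t T

/-- The `BX` norm of (the distribution given by) a function. -/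
def besovNormFun (f : Plane → ℝ) : ℝ≥0∞ := weightedSup fun t => heatFun t f

/-- `∇φ_v` for the potential `φ_v = -E₂ * v`, that is `∇φ_v = -(∇E₂) * v`. -/
def gradPotential (v : Plane → ℝ) (x : Plane) : Plane :=
  -∫ y, v y • gradient fundamentalSol (x - y)

/-- The distribution `B(u,v) = ∇ · (u ∇φ_v)` evaluated at a test function:
`⟨B(u,v), ψ⟩ = -∫ u ∇φ_v · ∇ψ`. -/
def bilinearB (u v : Plane → ℝ) (ψ : Plane → ℝ) : ℝ :=
  -∫ y, u y * inner ℝ (gradPotential v y) (gradient ψ y)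

/-- `(e^{tΔ} B(u,v))(x) = ⟨B(u,v), G(x - ·, t)⟩`. -/
def heatB (t : ℝ) (u v : Plane → ℝ) (x : Plane) : ℝ :=
  bilinearB u v fun y => heatKernel t (x - y)

/-- The space in which solutions with initial datum `u₀` are sought: measurable functions of
positive time with values in `L^{4/3}`, bounded in `BX`, with
`sup_{t > 0} t^{1/4} ‖u(t)‖_{4/3} < ∞`, which attain `u₀` as `t → 0⁺` in the sense of tempered
distributions. -/
structure MemSolutionSpace (u₀ : Tempered) (u : ℝ → Plane → ℝ) : Prop where
  aestronglyMeasurable :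
    AEStronglyMeasurable (Function.uncurry u) ((volume.restrict (Ioi (0 : ℝ))).prod volume)
  memLp : ∀ t : ℝ, 0 < t → MemLp (u t) (4 / 3) volume
  weightedSup_lt_top : weightedSup u < ⊤
  besov_lt_top : ⨆ (t : ℝ) (_ : 0 < t), besovNormFun (u t) < ⊤
  initial : ∀ ψ : 𝓢(Plane, ℝ), Tendsto (fun t => ∫ x, ψ x * u t x) (𝓝[>] 0) (𝓝 (u₀ ψ))

/-- A global mild solution with initial datum `u₀`: an element of the solution space with
`u(t) = e^{tΔ}u₀ + ∫₀ᵗ e^{(t-τ)Δ} ∇ · (u ∇φ_u)(τ) dτ` almost everywhere on the plane,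
for every `t > 0`. -/
structure IsMildSolution (u₀ : Tempered) (u : ℝ → Plane → ℝ) : Prop where
  mem : MemSolutionSpace u₀ u
  duhamel : ∀ t : ℝ, 0 < t →
    u t =ᵐ[volume] fun x => heat t u₀ x + ∫ τ in (0 : ℝ)..t, heatB (t - τ) (u τ) (u τ) x

end

end DebyeNernstPlanck

open DebyeNernstPlanck

namespace DebyeNernstPlanck

/-! Put `W(t) = t^{1/4}‖u(t) - v(t)‖_{4/3}` and `H(t) = t^{1/4}‖e^{tΔ}(u₀ - v₀)‖_{4/3}`. Subtracting
the two mild formulas shows that `W` and `H` differ by at most the weighted norm of the difference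
of the nonlinear terms, and everything rests on bounding the latter by `k · A[W](t)`, with `k`
proportional to `ε` and `A[W](t) = t^{1/4} ∫₀ᵗ (t-τ)^{-3/4} τ^{-1/2} W(τ) dτ`
(`exists_weighted_duhamelTerm_sub_le`).

That bound combines three facts. The flux `u∇φ_u` is the product of an `L^{4/3}` function with a
Riesz potential of one, hence lies in `L¹` by `exists_hardyLittlewoodSobolev`, and its difference is
bilinear. The kernel `∇G(·,s)` has `L^{4/3}` norm at most `C s^{-3/4}`
(`exists_lintegral_heatFlux_le`). Minkowski's inequality over space-time joins the two
(`lintegral_lintegral_mul_rpow_le`).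

The average `A` is scale invariant, has mass at most 12, and forgets any bounded time interval as `t
→ ∞`; so `limsup A[W] ≤ 12 limsup W` (`limsup_duhamelAverage_le`). If `H → 0`, then `limsup W ≤ 12 k
limsup W` with `12 k ≤ 1/2` and a finite limsup, which forces `W → 0`. If `W → 0`, then `A[W] → 0`
and `H ≤ W + k A[W] → 0`. -/

/-! ### General integral inequalities. -/

/-- The difference of two Bochner integrals is controlled by the lower integral of the difference,
whether or not the two functions are integrable. -/
theorem enorm_integral_sub_integral_le {α E : Type*} [MeasurableSpace α] {μ : Measure α}
    [NormedAddCommGroup E] [NormedSpace ℝ E] {f g : α → E}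
    (hf : AEStronglyMeasurable f μ) (hg : AEStronglyMeasurable g μ) :
    ‖(∫ a, f a ∂μ) - ∫ a, g a ∂μ‖ₑ ≤ ∫⁻ a, ‖f a - g a‖ₑ ∂μ := by
  by_cases h : ∫⁻ a, ‖f a - g a‖ₑ ∂μ = ⊤
  · rw [h]; exact le_top
  have hfg : Integrable (fun a => f a - g a) μ := ⟨hf.sub hg, lt_top_iff_ne_top.2 h⟩
  by_cases hfi : Integrable f μ
  · have hgi : Integrable g μ := by
      have := hfi.sub hfg
      refine this.congr (Eventually.of_forall fun a => ?_)
      simp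
    rw [← integral_sub hfi hgi]
    exact enorm_integral_le_lintegral_enorm _
  -- As `f - g` is integrable, `f` and `g` fail to be integrable together, and both integrals then
  -- take the default value 0.
  · have hgi : ¬ Integrable g μ := fun hgi => hfi <| by
      refine (hfg.add hgi).congr (Eventually.of_forall fun a => ?_)
      simp
    rw [integral_undef hfi, integral_undef hgi]
    simp

/-- **Minkowski's integral inequality** for a weighted superposition of the functions `k · z`, whose
`L^p` norms are at most `c z`. -/
theorem lintegral_lintegral_mul_rpow_le {α β : Type*} [MeasurableSpace α] [MeasurableSpace β]
    {μ : Measure α} {ν : Measure β} [SFinite μ] [SFinite ν] {p q : ℝ} (hpq : p.HolderConjugate q)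
    {k : α → β → ℝ≥0∞} {c F : β → ℝ≥0∞} (hk : Measurable (Function.uncurry k))
    (hc : Measurable c) (hF : Measurable F) (hc0 : ∀ᵐ z ∂ν, c z ≠ 0) (hct : ∀ᵐ z ∂ν, c z ≠ ⊤)
    (hkc : ∀ᵐ z ∂ν, ∫⁻ x, k x z ^ p ∂μ ≤ c z ^ p) :
    ∫⁻ x, (∫⁻ z, k x z * F z ∂ν) ^ p ∂μ ≤ (∫⁻ z, c z * F z ∂ν) ^ p := by
  have hp := hpq.pos
  have hq := hpq.symm.pos
  have hsum : 1 / p + 1 / q = 1 := by simpa using hpq.inv_add_inv_eq_one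
  have hpq1 : p / q = p - 1 := hpq.div_conj_eq_sub_one
  set A : ℝ≥0∞ := ∫⁻ z, c z * F z ∂ν with hA
  have hpt : ∀ x, (∫⁻ z, k x z * F z ∂ν) ^ p
      ≤ (∫⁻ z, k x z ^ p * (c z ^ (-(p / q)) * F z) ∂ν) * A ^ (p / q) := by
    intro x
    have hkx : Measurable (k x) := hk.comp measurable_prodMk_left
    -- Hölder with the factors weighted by powers of `c`: after Tonelli the `x`-integral of `k^p`
    -- costs `c^p`, and `c^{-p/q}` brings this down to `c`, so that `∫ c F` reappears.
    have hh := ENNReal.lintegral_mul_le_Lp_mul_Lq ν hpq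
      (f := fun z => k x z * c z ^ (-(1 / q)) * F z ^ (1 / p))
      (g := fun z => c z ^ (1 / q) * F z ^ (1 / q))
      (by fun_prop) (by fun_prop)
    have e1 : ∫⁻ z, k x z * F z ∂ν = ∫⁻ z, ((fun z => k x z * c z ^ (-(1 / q)) * F z ^ (1 / p)) *
        fun z => c z ^ (1 / q) * F z ^ (1 / q)) z ∂ν := by
      refine lintegral_congr_ae ?_
      filter_upwards [hc0, hct] with z h0 ht
      simp only [Pi.mul_apply]
      have h1 : c z ^ (-(1 / q)) * c z ^ (1 / q) = 1 := by
        rw [← ENNReal.rpow_add _ _ h0 ht]; simp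
      have h2 : F z ^ (1 / p) * F z ^ (1 / q) = F z := by
        rw [← ENNReal.rpow_add_of_nonneg _ _ (by positivity) (by positivity), hsum,
          ENNReal.rpow_one]
      calc k x z * F z = k x z * (c z ^ (-(1 / q)) * c z ^ (1 / q))
            * (F z ^ (1 / p) * F z ^ (1 / q)) := by rw [h1, h2, mul_one]
        _ = _ := by ring
    have e2 : ∀ z, (k x z * c z ^ (-(1 / q)) * F z ^ (1 / p)) ^ p
        = k x z ^ p * (c z ^ (-(p / q)) * F z) := by
      intro z
      rw [ENNReal.mul_rpow_of_nonneg _ _ hp.le, ENNReal.mul_rpow_of_nonneg _ _ hp.le,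
        ← ENNReal.rpow_mul, ← ENNReal.rpow_mul, one_div_mul_cancel hp.ne', ENNReal.rpow_one,
        mul_assoc]
      congr 3
      ring
    have e3 : ∀ z, (c z ^ (1 / q) * F z ^ (1 / q)) ^ q = c z * F z := by
      intro z
      rw [ENNReal.mul_rpow_of_nonneg _ _ hq.le,
        ← ENNReal.rpow_mul, ← ENNReal.rpow_mul, one_div_mul_cancel hq.ne', ENNReal.rpow_one,
        ENNReal.rpow_one]
    simp only [e2, e3] at hh
    rw [← e1] at hh
    calc (∫⁻ z, k x z * F z ∂ν) ^ p ≤ _ := ENNReal.rpow_le_rpow hh hp.le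
      _ = _ := by
        rw [ENNReal.mul_rpow_of_nonneg _ _ hp.le, ← ENNReal.rpow_mul, ← ENNReal.rpow_mul,
          one_div_mul_cancel hp.ne', ENNReal.rpow_one]
        congr 2
        ring
  have hm : Measurable (Function.uncurry fun x z => k x z ^ p * (c z ^ (-(p / q)) * F z)) := by
    have : (Function.uncurry fun x z => k x z ^ p * (c z ^ (-(p / q)) * F z))
      = fun w : α × β => Function.uncurry k w ^ p * (c w.2 ^ (-(p / q)) * F w.2) := by
        ext w; rfl
    rw [this]
    fun_prop
  calc ∫⁻ x, (∫⁻ z, k x z * F z ∂ν) ^ p ∂μ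
      ≤ ∫⁻ x, (∫⁻ z, k x z ^ p * (c z ^ (-(p / q)) * F z) ∂ν) * A ^ (p / q) ∂μ :=
        lintegral_mono hpt
    _ = (∫⁻ x, ∫⁻ z, k x z ^ p * (c z ^ (-(p / q)) * F z) ∂ν ∂μ) * A ^ (p / q) :=
        lintegral_mul_const _ hm.lintegral_prod_right'
    _ = (∫⁻ z, ∫⁻ x, k x z ^ p * (c z ^ (-(p / q)) * F z) ∂μ ∂ν) * A ^ (p / q) := by
        rw [lintegral_lintegral_swap hm.aemeasurable]
    _ ≤ A * A ^ (p / q) := by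
        gcongr
        refine lintegral_mono_ae ?_
        filter_upwards [hc0, hct, hkc] with z h0 ht hz
        have hkz : Measurable fun x => k x z := hk.comp measurable_prodMk_right
        rw [lintegral_mul_const _ (by fun_prop)]
        calc (∫⁻ x, k x z ^ p ∂μ) * (c z ^ (-(p / q)) * F z)
            ≤ c z ^ p * (c z ^ (-(p / q)) * F z) := by gcongr
          _ = c z * F z := by
            rw [← mul_assoc, ← ENNReal.rpow_add _ _ h0 ht, hpq1,
              show p + -(p - 1) = 1 by ring, ENNReal.rpow_one]
    _ = A ^ p := by
        nth_rw 1 [← ENNReal.rpow_one A]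
        rw [← ENNReal.rpow_add_of_nonneg _ _ zero_le_one (by positivity), hpq1]
        simp

/-! ### Scaling, power integrals and the Duhamel time average. -/

theorem lintegral_comp_inv_smul (f : Plane → ℝ≥0∞) {r : ℝ} (hr : 0 < r) :
    ∫⁻ y, f (r⁻¹ • y) = ENNReal.ofReal (r ^ 2) * ∫⁻ y, f y := by
  have hm := Measure.map_addHaar_smul (volume : Measure Plane) (inv_pos.2 hr).ne'
  have he : MeasurableEmbedding fun y : Plane => r⁻¹ • y :=
    (Homeomorph.smulOfNeZero r⁻¹ (inv_pos.2 hr).ne').measurableEmbedding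
  have := he.lintegral_map (μ := volume) f
  rw [hm, lintegral_smul_measure] at this
  rw [← this]
  simp [abs_of_pos hr]

theorem setLIntegral_rpow {r a : ℝ} (hr : -1 < r) (ha : 0 ≤ a) :
    ∫⁻ τ in Ioo 0 a, ENNReal.ofReal (τ ^ r) = ENNReal.ofReal (a ^ (r + 1) / (r + 1)) := by
  have hi : IntervalIntegrable (fun τ : ℝ => τ ^ r) volume 0 a :=
    intervalIntegral.intervalIntegrable_rpow' hr
  have h := integral_rpow (a := 0) (b := a) (r := r) (Or.inl hr)
  rw [Real.zero_rpow (by linarith), sub_zero, intervalIntegral.integral_of_le ha] at h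
  rw [← h, ofReal_integral_eq_lintegral_ofReal ((intervalIntegrable_iff_integrableOn_Ioc_of_le ha).1 hi),
    setLIntegral_congr Ioo_ae_eq_Ioc]
  exact (ae_restrict_mem measurableSet_Ioc).mono fun τ hτ => Real.rpow_nonneg hτ.1.le _

theorem setLIntegral_sub_rpow {r a t : ℝ} (hr : -1 < r) (ha : a ≤ t) :
    ∫⁻ τ in Ioo a t, ENNReal.ofReal ((t - τ) ^ r)
      = ENNReal.ofReal ((t - a) ^ (r + 1) / (r + 1)) := by
  rw [← setLIntegral_rpow hr (by linarith : 0 ≤ t - a), ← lintegral_indicator measurableSet_Ioo,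
    ← lintegral_indicator measurableSet_Ioo, ← lintegral_sub_left_eq_self _ t]
  refine lintegral_congr fun τ => ?_
  by_cases h : t - τ ∈ Ioo a t
  · have h' : τ ∈ Ioo 0 (t - a) := ⟨by linarith [h.2], by linarith [h.1]⟩
    rw [indicator_of_mem h, indicator_of_mem h', sub_sub_cancel]
  · have h' : τ ∉ Ioo 0 (t - a) := fun h' => h ⟨by linarith [h'.2], by linarith [h'.1]⟩
    rw [indicator_of_notMem h, indicator_of_notMem h']

/-- The Duhamel weight `(t-τ)^{-3/4} τ^{-1/2}`. -/
noncomputable def duhamelWeight (t τ : ℝ) : ℝ≥0∞ :=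
  ENNReal.ofReal ((t - τ) ^ (-(3 / 4) : ℝ)) * ENNReal.ofReal (τ ^ (-(1 / 2) : ℝ))

theorem measurable_duhamelWeight (t : ℝ) : Measurable (duhamelWeight t) := by
  unfold duhamelWeight; fun_prop

/-- For `τ < T ≤ t/2` the factor `(t-τ)^{-3/4}` is harmless. Taking `T = t/2` gives half of the mass
estimate; a fixed `T` gives decay `t^{-3/4}`, which beats the prefactor `t^{1/4}`. -/
theorem setLIntegral_duhamelWeight_initial_le {t T : ℝ} (hT : 0 ≤ T) (ht : 2 * T ≤ t) (h0 : 0 < t) :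
    ∫⁻ τ in Ioo 0 T, duhamelWeight t τ
      ≤ ENNReal.ofReal ((t / 2) ^ (-(3 / 4) : ℝ) * (2 * T ^ (1 / 2 : ℝ))) := by
  calc ∫⁻ τ in Ioo 0 T, duhamelWeight t τ
      ≤ ∫⁻ τ in Ioo 0 T, ENNReal.ofReal ((t / 2) ^ (-(3 / 4) : ℝ))
          * ENNReal.ofReal (τ ^ (-(1 / 2) : ℝ)) := by
        refine setLIntegral_mono (by fun_prop) fun τ hτ => ?_
        unfold duhamelWeight
        gcongr ENNReal.ofReal ?_ * _
        exact Real.rpow_le_rpow_of_nonpos (by positivity) (by linarith [hτ.2]) (by norm_num)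
    _ = _ := by
        rw [lintegral_const_mul _ (by fun_prop), setLIntegral_rpow (by norm_num) hT,
          ← ENNReal.ofReal_mul (by positivity)]
        congr 2
        norm_num
        ring

theorem setLIntegral_duhamelWeight_final_le {t : ℝ} (h0 : 0 < t) :
    ∫⁻ τ in Ioo (t / 2) t, duhamelWeight t τ
      ≤ ENNReal.ofReal ((t / 2) ^ (-(1 / 2) : ℝ) * (4 * (t / 2) ^ (1 / 4 : ℝ))) := by
  calc ∫⁻ τ in Ioo (t / 2) t, duhamelWeight t τ
      ≤ ∫⁻ τ in Ioo (t / 2) t, ENNReal.ofReal ((t - τ) ^ (-(3 / 4) : ℝ))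
          * ENNReal.ofReal ((t / 2) ^ (-(1 / 2) : ℝ)) := by
        refine setLIntegral_mono (by fun_prop) fun τ hτ => ?_
        unfold duhamelWeight
        gcongr _ * ENNReal.ofReal ?_
        exact Real.rpow_le_rpow_of_nonpos (by positivity) hτ.1.le (by norm_num)
    _ = _ := by
        rw [lintegral_mul_const _ (by fun_prop), setLIntegral_sub_rpow (by norm_num) (by linarith),
          ← ENNReal.ofReal_mul 
            (by have := Real.rpow_nonneg (show 0 ≤ t - t / 2 by linarith) (-(3 / 4) + 1); positivity)]
        congr 1
        norm_num
        rw [show t - t / 2 = t / 2 by ring]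
        ring

/-- By homogeneity the left side does not depend on `t`. The two halves contribute 2 and 4 times
`(t/2)^{-1/4}`, and `6 · 2^{1/4} ≤ 12`. -/
theorem setLIntegral_duhamelWeight_le {t : ℝ} (h0 : 0 < t) :
    ENNReal.ofReal (t ^ (1 / 4 : ℝ)) * ∫⁻ τ in Ioo 0 t, duhamelWeight t τ ≤ 12 := by
  have hsplit : ∫⁻ τ in Ioo 0 t, duhamelWeight t τ
      ≤ ENNReal.ofReal (6 * (t / 2) ^ (-(1 / 4) : ℝ)) := by
    calc ∫⁻ τ in Ioo 0 t, duhamelWeight t τ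
        = ∫⁻ τ in Ioo 0 (t / 2) ∪ Ioo (t / 2) t, duhamelWeight t τ := by
          rw [← Ioc_union_Ioo_eq_Ioo (b := t / 2) (by linarith) (by linarith)]
          exact setLIntegral_congr (Ioo_ae_eq_Ioc.symm.union (ae_eq_refl _))
      _ ≤ _ := (lintegral_union_le _ _ _).trans (add_le_add
          (setLIntegral_duhamelWeight_initial_le (by linarith) (by linarith) h0)
          (setLIntegral_duhamelWeight_final_le h0))
      _ = _ := by
          rw [← ENNReal.ofReal_add (by positivity) (by positivity)]
          congr 1
          have e1 : (t / 2) ^ (-(3 / 4) : ℝ) * (t / 2) ^ (1 / 2 : ℝ) = (t / 2) ^ (-(1 / 4) : ℝ) := by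
            rw [← Real.rpow_add (by positivity)]; norm_num
          have e2 : (t / 2) ^ (-(1 / 2) : ℝ) * (t / 2) ^ (1 / 4 : ℝ) = (t / 2) ^ (-(1 / 4) : ℝ) := by
            rw [← Real.rpow_add (by positivity)]; norm_num
          linear_combination 2 * e1 + 4 * e2
  calc _ ≤ ENNReal.ofReal (t ^ (1 / 4 : ℝ)) * ENNReal.ofReal (6 * (t / 2) ^ (-(1 / 4) : ℝ)) := by
        gcongr
    _ = ENNReal.ofReal (6 * 2 ^ (1 / 4 : ℝ)) := by
        rw [← ENNReal.ofReal_mul (by positivity)]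
        congr 1
        rw [Real.div_rpow h0.le (by norm_num), Real.rpow_neg h0.le, Real.rpow_neg (by norm_num)]
        field_simp
    _ ≤ ENNReal.ofReal 12 := by
        apply ENNReal.ofReal_le_ofReal
        have : (2 : ℝ) ^ (1 / 4 : ℝ) ≤ 2 ^ (1 : ℝ) :=
          Real.rpow_le_rpow_of_exponent_le (by norm_num) (by norm_num)
        rw [Real.rpow_one] at this
        linarith
    _ = 12 := by norm_num

/-- The time average `t^{1/4} ∫₀ᵗ (t-τ)^{-3/4} τ^{-1/2} W(τ) dτ`. -/
noncomputable def duhamelAverage (W : ℝ → ℝ≥0∞) (t : ℝ) : ℝ≥0∞ :=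
  ENNReal.ofReal (t ^ (1 / 4 : ℝ)) * ∫⁻ τ in Ioo 0 t, duhamelWeight t τ * W τ

/-- Split at a time `T` after which `W ≤ a`: the part before `T` vanishes in the limit, the part
after has mass at most 12. Only measurable majorants of `W` are integrated separately, so `W` need
not be measurable. -/
theorem limsup_duhamelAverage_le {W : ℝ → ℝ≥0∞} {M : ℝ≥0∞} (hM : M ≠ ⊤)
    (hW : ∀ τ, 0 < τ → W τ ≤ M) :
    limsup (duhamelAverage W) atTop ≤ 12 * limsup W atTop := by
  have key : ∀ a : ℝ≥0∞, limsup W atTop < a → limsup (duhamelAverage W) atTop ≤ 12 * a := by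
    intro a ha
    obtain ⟨T, hT0, hT⟩ : ∃ T : ℝ, 0 < T ∧ ∀ τ, T ≤ τ → W τ ≤ a := by
      obtain ⟨T, hT⟩ := eventually_atTop.1 (eventually_lt_of_limsup_lt ha)
      exact ⟨max T 1, by positivity, fun τ hτ => (hT τ ((le_max_left _ _).trans hτ)).le⟩
    -- Contribution of `(0, T)`: `t^{1/4} (t/2)^{-3/4} · 2 T^{1/2}` times the bound `M`.
    set e : ℝ → ℝ≥0∞ := fun t =>
      ENNReal.ofReal (2 ^ (3 / 4 : ℝ) * (2 * T ^ (1 / 2 : ℝ)) * t ^ (-(1 / 2) : ℝ)) * M with he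
    have hbound : ∀ᶠ t in atTop, duhamelAverage W t ≤ e t + 12 * a := by
      filter_upwards [eventually_ge_atTop (2 * T)] with t ht
      have h0 : 0 < t := by linarith
      have hpt : ∀ τ ∈ Ioo 0 t, duhamelWeight t τ * W τ
          ≤ (Ioo 0 T).indicator (fun τ => duhamelWeight t τ * M) τ + duhamelWeight t τ * a := by
        intro τ hτ
        rcases lt_or_ge τ T with h | h
        · rw [indicator_of_mem (show τ ∈ Ioo 0 T from ⟨hτ.1, h⟩)]
          exact le_add_right (by gcongr; exact hW τ hτ.1)
        · exact le_add_left (by gcongr; exact hT τ h)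
      have hmw := measurable_duhamelWeight t
      have hI : ∫⁻ τ in Ioo 0 t, duhamelWeight t τ * W τ
          ≤ (∫⁻ τ in Ioo 0 T, duhamelWeight t τ) * M + (∫⁻ τ in Ioo 0 t, duhamelWeight t τ) * a := by
        calc _ ≤ ∫⁻ τ in Ioo 0 t, ((Ioo 0 T).indicator (fun τ => duhamelWeight t τ * M) τ
              + duhamelWeight t τ * a) :=
              setLIntegral_mono' measurableSet_Ioo hpt
          _ = (∫⁻ τ in Ioo 0 t, (Ioo 0 T).indicator (fun τ => duhamelWeight t τ * M) τ)
              + ∫⁻ τ in Ioo 0 t, duhamelWeight t τ * a :=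
              lintegral_add_right _ (by fun_prop)
          _ ≤ _ := by
              rw [lintegral_mul_const _ hmw]
              gcongr
              refine (lintegral_mono' Measure.restrict_le_self le_rfl).trans ?_
              rw [lintegral_indicator measurableSet_Ioo, lintegral_mul_const _ hmw]
      unfold duhamelAverage
      calc _ ≤ ENNReal.ofReal (t ^ (1 / 4 : ℝ)) * ((∫⁻ τ in Ioo 0 T, duhamelWeight t τ) * M
            + (∫⁻ τ in Ioo 0 t, duhamelWeight t τ) * a) := by gcongr
        _ = ENNReal.ofReal (t ^ (1 / 4 : ℝ)) * (∫⁻ τ in Ioo 0 T, duhamelWeight t τ) * M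
            + ENNReal.ofReal (t ^ (1 / 4 : ℝ)) * (∫⁻ τ in Ioo 0 t, duhamelWeight t τ) * a := by ring
        _ ≤ e t + 12 * a := by
          refine add_le_add (mul_le_mul' ?_ le_rfl)
            (mul_le_mul' (setLIntegral_duhamelWeight_le h0) le_rfl)
          · calc _ ≤ ENNReal.ofReal (t ^ (1 / 4 : ℝ)) *
                  ENNReal.ofReal ((t / 2) ^ (-(3 / 4) : ℝ) * (2 * T ^ (1 / 2 : ℝ))) := by
                  gcongr
                  exact setLIntegral_duhamelWeight_initial_le hT0.le ht h0
              _ = _ := by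
                  rw [← ENNReal.ofReal_mul (by positivity)]
                  congr 1
                  have e1 : t ^ (-(1 / 2) : ℝ) = t ^ (1 / 4 : ℝ) * t ^ (-(3 / 4) : ℝ) := by
                    rw [← Real.rpow_add h0]; norm_num
                  rw [e1, Real.div_rpow h0.le (by norm_num), Real.rpow_neg (by norm_num : (0:ℝ) ≤ 2)]
                  field_simp
    have het : Tendsto (fun t => e t + 12 * a) atTop (𝓝 (0 + 12 * a)) := by
      refine Tendsto.add ?_ tendsto_const_nhds
      have h1 : Tendsto (fun t : ℝ => t ^ (-(1 / 2) : ℝ)) atTop (𝓝 0) :=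
        tendsto_rpow_neg_atTop (by norm_num)
      have h2 := ENNReal.tendsto_ofReal (h1.const_mul (2 ^ (3 / 4 : ℝ) * (2 * T ^ (1 / 2 : ℝ))))
      rw [mul_zero, ENNReal.ofReal_zero] at h2
      have h3 := ENNReal.Tendsto.mul_const h2 (Or.inr hM)
      rwa [zero_mul] at h3
    calc limsup (duhamelAverage W) atTop ≤ limsup (fun t => e t + 12 * a) atTop :=
          limsup_le_limsup hbound
      _ = 12 * a := by rw [het.limsup_eq, zero_add]
  have hL : limsup W atTop ≠ ⊤ := by
    refine ne_top_of_le_ne_top hM (limsup_le_of_le (by isBoundedDefault) ?_)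
    filter_upwards [eventually_gt_atTop 0] with t ht using hW t ht
  -- `key` needs a level strictly above the limsup; use `limsup W + d` and let `d` decrease to 0.
  have hd : Tendsto (fun d : ℝ≥0∞ => 12 * (limsup W atTop + d)) (𝓝[>] 0)
      (𝓝 (12 * (limsup W atTop + 0))) :=
    (ENNReal.Tendsto.const_mul (tendsto_const_nhds.add tendsto_id)
      (Or.inr (by norm_num))).mono_left nhdsWithin_le_nhds
  rw [add_zero] at hd
  refine ge_of_tendsto hd ?_
  filter_upwards [self_mem_nhdsWithin] with d hd0
  exact key _ (ENNReal.lt_add_right hL (ne_of_gt hd0))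

/-! ### The Hardy–Littlewood–Sobolev inequality in the plane. -/

theorem enorm_inv_smul {r : ℝ} (hr : 0 < r) (y : Plane) :
    ‖r⁻¹ • y‖ₑ⁻¹ = ENNReal.ofReal r * ‖y‖ₑ⁻¹ := by
  rw [enorm_smul, enorm_inv hr.ne', ENNReal.mul_inv (by simp) (by simp [hr.ne']), inv_inv,
    Real.enorm_of_nonneg hr.le]

theorem setLIntegral_ball_inv_enorm (x : Plane) {R : ℝ} (hR : 0 < R) :
    ∫⁻ y in Metric.ball x R, ‖x - y‖ₑ⁻¹
      = ENNReal.ofReal R * ∫⁻ y in Metric.ball (0 : Plane) 1, ‖y‖ₑ⁻¹ := by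
  set g : Plane → ℝ≥0∞ := (Metric.ball (0 : Plane) 1).indicator fun y => ‖y‖ₑ⁻¹ with hg
  have h1 : ∀ y, (Metric.ball x R).indicator (fun y => ‖x - y‖ₑ⁻¹) y
      = ENNReal.ofReal R⁻¹ * g (R⁻¹ • (x - y)) := by
    intro y
    have hm : y ∈ Metric.ball x R ↔ R⁻¹ • (x - y) ∈ Metric.ball (0 : Plane) 1 := by
      rw [Metric.mem_ball, mem_ball_zero_iff, norm_smul, norm_inv, Real.norm_of_nonneg hR.le,
        dist_comm, dist_eq_norm, inv_mul_lt_iff₀ hR, mul_one]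
    by_cases h : y ∈ Metric.ball x R
    · rw [hg, indicator_of_mem h, indicator_of_mem (hm.1 h), enorm_inv_smul hR, ← mul_assoc,
        ← ENNReal.ofReal_mul (by positivity), inv_mul_cancel₀ hR.ne', ENNReal.ofReal_one, one_mul]
    · rw [hg, indicator_of_notMem h, indicator_of_notMem (fun h' => h (hm.2 h')), mul_zero]
  rw [← lintegral_indicator measurableSet_ball, ← lintegral_indicator measurableSet_ball]
  simp only [h1]
  rw [lintegral_const_mul' _ _ ENNReal.ofReal_ne_top,
    lintegral_sub_left_eq_self (fun y => g (R⁻¹ • y)) x, lintegral_comp_inv_smul g hR, ← mul_assoc,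
    ← ENNReal.ofReal_mul (by positivity)]
  congr 2
  field_simp

theorem setLIntegral_compl_ball_inv_enorm (x : Plane) {R : ℝ} (hR : 0 < R) :
    ∫⁻ y in (Metric.ball x R)ᶜ, ‖x - y‖ₑ⁻¹ ^ (4 : ℝ)
      = ENNReal.ofReal (R ^ (-2 : ℝ)) * ∫⁻ y in (Metric.ball (0 : Plane) 1)ᶜ, ‖y‖ₑ⁻¹ ^ (4 : ℝ) := by
  set g : Plane → ℝ≥0∞ := (Metric.ball (0 : Plane) 1)ᶜ.indicator fun y => ‖y‖ₑ⁻¹ ^ (4 : ℝ) with hg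
  have h1 : ∀ y, (Metric.ball x R)ᶜ.indicator (fun y => ‖x - y‖ₑ⁻¹ ^ (4 : ℝ)) y
      = ENNReal.ofReal (R ^ (-4 : ℝ)) * g (R⁻¹ • (x - y)) := by
    intro y
    have hm : y ∈ (Metric.ball x R)ᶜ ↔ R⁻¹ • (x - y) ∈ (Metric.ball (0 : Plane) 1)ᶜ := by
      rw [mem_compl_iff, mem_compl_iff, Metric.mem_ball, mem_ball_zero_iff, norm_smul, norm_inv,
        Real.norm_of_nonneg hR.le, dist_comm, dist_eq_norm, inv_mul_lt_iff₀ hR, mul_one]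
    by_cases h : y ∈ (Metric.ball x R)ᶜ
    · rw [hg, indicator_of_mem h, indicator_of_mem (hm.1 h), enorm_inv_smul hR,
        ENNReal.mul_rpow_of_nonneg _ _ (by norm_num), ← mul_assoc,
        ENNReal.ofReal_rpow_of_pos hR, ← ENNReal.ofReal_mul (by positivity),
        ← Real.rpow_add hR]
      norm_num
    · rw [hg, indicator_of_notMem h, indicator_of_notMem (fun h' => h (hm.2 h')), mul_zero]
  rw [← lintegral_indicator measurableSet_ball.compl,
    ← lintegral_indicator measurableSet_ball.compl]
  simp only [h1]
  rw [lintegral_const_mul' _ _ ENNReal.ofReal_ne_top,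
    lintegral_sub_left_eq_self (fun y => g (R⁻¹ • y)) x, lintegral_comp_inv_smul g hR, ← mul_assoc,
    ← ENNReal.ofReal_mul (by positivity), ← Real.rpow_natCast, ← Real.rpow_add hR]
  norm_num [hg]

theorem lintegral_unitBall_inv_enorm_lt_top :
    ∫⁻ y in Metric.ball (0 : Plane) 1, ‖y‖ₑ⁻¹ < ⊤ := by
  have h : IntegrableOn (fun y : Plane => ‖y‖⁻¹) (Metric.ball 0 1) volume := by
    refine integrableOn_ball_of_norm_le_rpow (C := 1) (α := 1) (by simp) (by simp)
      (Eventually.of_forall fun y => ?_) (by fun_prop)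
    rw [Real.rpow_neg_one, one_mul, Real.norm_of_nonneg (by positivity)]
  refine lt_of_eq_of_lt (lintegral_congr_ae ?_) h.2
  have h0 : ∀ᵐ y : Plane, y ≠ 0 := by simp [ae_iff]
  filter_upwards [ae_restrict_of_ae h0] with y hy
  rw [enorm_inv (norm_ne_zero_iff.2 hy), enorm_norm]

theorem lintegral_compl_unitBall_inv_enorm_lt_top :
    ∫⁻ y in (Metric.ball (0 : Plane) 1)ᶜ, ‖y‖ₑ⁻¹ ^ (4 : ℝ) < ⊤ := by
  have h := finite_integral_one_add_norm (E := Plane) (μ := volume) (r := 4) (by simp; norm_num)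
  -- Outside the unit ball `1 + ‖y‖ ≤ 2‖y‖`, and `16 = 2 ^ 4`.
  refine lt_of_le_of_lt (b := ENNReal.ofReal 16 * ∫⁻ y : Plane, ENNReal.ofReal ((1 + ‖y‖) ^ (-4 : ℝ)))
    ?_ (ENNReal.mul_lt_top ENNReal.ofReal_lt_top h)
  rw [← lintegral_const_mul' _ _ ENNReal.ofReal_ne_top]
  refine (setLIntegral_mono' measurableSet_ball.compl fun y hy => ?_).trans
    (setLIntegral_le_lintegral _ _)
  have hy1 : 1 ≤ ‖y‖ := by simpa using hy
  have hy0 : 0 < ‖y‖ := by linarith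
  rw [← ofReal_norm, ← ENNReal.ofReal_inv_of_pos hy0, ENNReal.ofReal_rpow_of_pos (by positivity),
    ← ENNReal.ofReal_mul (by norm_num)]
  apply ENNReal.ofReal_le_ofReal
  rw [Real.rpow_neg (by positivity), ← div_eq_mul_inv, Real.inv_rpow hy0.le, inv_eq_one_div,
    div_le_div_iff₀ (by positivity) (by positivity), one_mul]
  calc (1 + ‖y‖) ^ (4 : ℝ) ≤ (2 * ‖y‖) ^ (4 : ℝ) := by
        gcongr; linarith
    _ = 16 * ‖y‖ ^ (4 : ℝ) := by
        rw [Real.mul_rpow (by norm_num) hy0.le]; norm_num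

/-- The Riesz potential of order one of the truncation of `h` at the height `a`, evaluated at
`x`. -/
theorem exists_setLIntegral_mul_inv_enorm_le :
    ∃ C : ℝ≥0∞, C ≠ ⊤ ∧ ∀ h : Plane → ℝ≥0∞, Measurable h → ∫⁻ y, h y ^ (4 / 3 : ℝ) ≤ 1 →
      ∀ (a : ℝ≥0∞) (x : Plane),
        ∫⁻ y in {y | h y ≤ a}, h y * ‖x - y‖ₑ⁻¹ ≤ C * a ^ (1 / 3 : ℝ) := by
  set C₁ := ∫⁻ y in Metric.ball (0 : Plane) 1, ‖y‖ₑ⁻¹ with hC₁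
  set C₂ := ∫⁻ y in (Metric.ball (0 : Plane) 1)ᶜ, ‖y‖ₑ⁻¹ ^ (4 : ℝ) with hC₂
  have hC₂t := lintegral_compl_unitBall_inv_enorm_lt_top
  -- The summand 1 keeps the constant nonzero, which makes the bound trivial for `a = ⊤`.
  refine ⟨1 + C₁ + C₂ ^ (1 / 4 : ℝ), ?_, fun h hh h1 a x => ?_⟩
  · exact ENNReal.add_ne_top.2 ⟨ENNReal.add_ne_top.2 ⟨by simp, lintegral_unitBall_inv_enorm_lt_top.ne⟩,
      ENNReal.rpow_ne_top_of_nonneg (by norm_num) hC₂t.ne⟩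
  rcases eq_or_ne a ⊤ with rfl | hat
  · rw [ENNReal.top_rpow_of_pos (by norm_num), ENNReal.mul_top (by simp)]
    exact le_top
  have hms : MeasurableSet {y | h y ≤ a} := measurableSet_le hh measurable_const
  rcases eq_or_ne a 0 with rfl | ha0
  · refine le_of_eq_of_le ?_ zero_le
    refine (setLIntegral_congr_fun hms fun y hy => ?_).trans lintegral_zero
    have : h y = 0 := by simpa using hy
    simp [this]
  obtain ⟨b, hb, rfl⟩ : ∃ b : ℝ, 0 < b ∧ a = ENNReal.ofReal b :=
    ⟨a.toReal, ENNReal.toReal_pos ha0 hat, (ENNReal.ofReal_toReal hat).symm⟩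
  -- This radius balances the near part, of order `b R` by the height bound, with the far part, of
  -- order `R^{-1/2}` by Hölder: both equal `b^{1/3}`.
  set R : ℝ := b ^ (-(2 / 3) : ℝ) with hR
  have hR0 : 0 < R := by positivity
  have hnear : ∫⁻ y in Metric.ball x R ∩ {y | h y ≤ ENNReal.ofReal b}, h y * ‖x - y‖ₑ⁻¹
      ≤ C₁ * ENNReal.ofReal b ^ (1 / 3 : ℝ) := by
    calc _ ≤ ∫⁻ y in Metric.ball x R ∩ {y | h y ≤ ENNReal.ofReal b},
            ENNReal.ofReal b * ‖x - y‖ₑ⁻¹ := by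
          refine setLIntegral_mono' (measurableSet_ball.inter hms) fun y hy => ?_
          gcongr
          exact hy.2
      _ ≤ ∫⁻ y in Metric.ball x R, ENNReal.ofReal b * ‖x - y‖ₑ⁻¹ :=
          lintegral_mono_set inter_subset_left
      _ = _ := by
          rw [lintegral_const_mul' _ _ ENNReal.ofReal_ne_top, setLIntegral_ball_inv_enorm x hR0,
            ← mul_assoc, ← ENNReal.ofReal_mul hb.le, mul_comm, ENNReal.ofReal_rpow_of_pos hb]
          congr 2
          nth_rw 1 [← Real.rpow_one b]
          rw [hR, ← Real.rpow_add hb]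
          norm_num
  have hfar : ∫⁻ y in (Metric.ball x R)ᶜ, h y * ‖x - y‖ₑ⁻¹
      ≤ C₂ ^ (1 / 4 : ℝ) * ENNReal.ofReal b ^ (1 / 3 : ℝ) := by
    have hpq : (4 / 3 : ℝ).HolderConjugate 4 := by
      rw [Real.holderConjugate_iff]; norm_num
    have hH := ENNReal.lintegral_mul_le_Lp_mul_Lq (volume.restrict (Metric.ball x R)ᶜ) hpq
      (f := h) (g := fun y => ‖x - y‖ₑ⁻¹) hh.aemeasurable (by fun_prop)
    refine hH.trans ?_
    have hle : (∫⁻ y in (Metric.ball x R)ᶜ, h y ^ (4 / 3 : ℝ)) ^ (1 / (4 / 3) : ℝ) ≤ 1 := by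
      calc _ ≤ (1 : ℝ≥0∞) ^ (1 / (4 / 3) : ℝ) := by
            refine ENNReal.rpow_le_rpow ?_ (by norm_num)
            exact (setLIntegral_le_lintegral _ _).trans h1
        _ = 1 := ENNReal.one_rpow _
    calc _ ≤ 1 * (∫⁻ y in (Metric.ball x R)ᶜ, ‖x - y‖ₑ⁻¹ ^ (4 : ℝ)) ^ (1 / 4 : ℝ) :=
          mul_le_mul' hle le_rfl
      _ = _ := by
          rw [one_mul, setLIntegral_compl_ball_inv_enorm x hR0,
            ENNReal.mul_rpow_of_nonneg _ _ (by norm_num), mul_comm, ENNReal.ofReal_rpow_of_pos hb,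
            ENNReal.ofReal_rpow_of_pos (by positivity), hR, ← Real.rpow_mul hb.le,
            ← Real.rpow_mul hb.le]
          norm_num [hC₂]
  calc ∫⁻ y in {y | h y ≤ ENNReal.ofReal b}, h y * ‖x - y‖ₑ⁻¹
      ≤ ∫⁻ y in (Metric.ball x R ∩ {y | h y ≤ ENNReal.ofReal b}) ∪ (Metric.ball x R)ᶜ,
          h y * ‖x - y‖ₑ⁻¹ := by
        refine lintegral_mono_set fun y hy => ?_
        by_cases hyb : y ∈ Metric.ball x R
        · exact Or.inl ⟨hyb, hy⟩
        · exact Or.inr hyb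
    _ ≤ _ := (lintegral_union_le _ _ _).trans (add_le_add hnear hfar)
    _ ≤ _ := by
        rw [← add_mul]
        gcongr
        exact le_add_self

/-- **Hardy–Littlewood–Sobolev inequality** for the kernel `|x - y|⁻¹` on the plane, in the bilinear
form on `L^{4/3}`. -/
theorem exists_hardyLittlewoodSobolev :
    ∃ C : ℝ≥0∞, C ≠ ⊤ ∧ ∀ f h : Plane → ℝ≥0∞, Measurable f → Measurable h →
      ∫⁻ x, f x * ∫⁻ y, h y * ‖x - y‖ₑ⁻¹
        ≤ C * ((∫⁻ x, f x ^ (4 / 3 : ℝ)) ^ (3 / 4 : ℝ) * (∫⁻ x, h x ^ (4 / 3 : ℝ)) ^ (3 / 4 : ℝ)) := by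
  obtain ⟨C, hC, hCb⟩ := exists_setLIntegral_mul_inv_enorm_le
  -- Where `h y ≤ f x`, truncate `h` at the height `a = f x`: the inner integral is at most `C
  -- f(x)^{1/3}`, and multiplying by `f x` yields `f^{4/3}`.
  have half : ∀ f h : Plane → ℝ≥0∞, Measurable f → Measurable h →
      ∫⁻ x, f x ^ (4 / 3 : ℝ) ≤ 1 → ∫⁻ x, h x ^ (4 / 3 : ℝ) ≤ 1 →
      ∫⁻ x, ∫⁻ y in {y | h y ≤ f x}, f x * (h y * ‖x - y‖ₑ⁻¹) ≤ C := by
    intro f h hf hh hf1 hh1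
    calc ∫⁻ x, ∫⁻ y in {y | h y ≤ f x}, f x * (h y * ‖x - y‖ₑ⁻¹)
        ≤ ∫⁻ x, C * f x ^ (4 / 3 : ℝ) := by
          refine lintegral_mono fun x => ?_
          rw [lintegral_const_mul _ (by fun_prop)]
          calc _ ≤ f x * (C * f x ^ (1 / 3 : ℝ)) := by
                gcongr
                exact hCb h hh hh1 (f x) x
            _ = C * (f x ^ (1 : ℝ) * f x ^ (1 / 3 : ℝ)) := by rw [ENNReal.rpow_one]; ring
            _ = _ := by
                rw [← ENNReal.rpow_add_of_nonneg _ _ (by norm_num) (by norm_num)]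
                norm_num
      _ = C * ∫⁻ x, f x ^ (4 / 3 : ℝ) := lintegral_const_mul' _ _ hC
      _ ≤ C * 1 := by gcongr
      _ = C := mul_one C
  have norm_one : ∀ f h : Plane → ℝ≥0∞, Measurable f → Measurable h →
      ∫⁻ x, f x ^ (4 / 3 : ℝ) ≤ 1 → ∫⁻ x, h x ^ (4 / 3 : ℝ) ≤ 1 →
      ∫⁻ x, f x * ∫⁻ y, h y * ‖x - y‖ₑ⁻¹ ≤ C + C := by
    intro f h hf hh hf1 hh1
    -- The kernel is symmetric, so the region `B` is the case `A` with `f` and `h` exchanged.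
    set A : Set (Plane × Plane) := {p | h p.2 ≤ f p.1}
    set B : Set (Plane × Plane) := {p | f p.1 ≤ h p.2}
    have hA : MeasurableSet A := measurableSet_le (by fun_prop) (by fun_prop)
    have hB : MeasurableSet B := measurableSet_le (by fun_prop) (by fun_prop)
    set K : Plane × Plane → ℝ≥0∞ := fun p => f p.1 * (h p.2 * ‖p.1 - p.2‖ₑ⁻¹) with hK
    have hKm : Measurable K := by fun_prop
    have hle : ∀ p, K p ≤ A.indicator K p + B.indicator K p := by
      intro p
      rcases le_total (h p.2) (f p.1) with hp | hp
      · rw [indicator_of_mem (show p ∈ A from hp)]; exact le_self_add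
      · rw [indicator_of_mem (show p ∈ B from hp)]; exact le_add_self
    have hAi : ∫⁻ x, ∫⁻ y, A.indicator K (x, y) ≤ C := by
      refine le_of_eq_of_le (lintegral_congr fun x => ?_) (half f h hf hh hf1 hh1)
      rw [← lintegral_indicator (measurableSet_le hh measurable_const)]
      rfl
    have hBi : ∫⁻ x, ∫⁻ y, B.indicator K (x, y) ≤ C := by
      rw [lintegral_lintegral_swap (f := fun x y => B.indicator K (x, y))
        (hKm.indicator hB).aemeasurable]
      refine le_of_eq_of_le (lintegral_congr fun y => ?_) (half h f hh hf hh1 hf1)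
      rw [← lintegral_indicator (measurableSet_le hf measurable_const)]
      refine lintegral_congr fun x => ?_
      by_cases hp : f x ≤ h y
      · rw [indicator_of_mem (show (x, y) ∈ B from hp),
          indicator_of_mem (show x ∈ {x | f x ≤ h y} from hp), hK, ← enorm_neg (y - x), neg_sub]
        ring
      · rw [indicator_of_notMem (show (x, y) ∉ B from hp),
          indicator_of_notMem (show x ∉ {x | f x ≤ h y} from hp)]
    calc ∫⁻ x, f x * ∫⁻ y, h y * ‖x - y‖ₑ⁻¹ = ∫⁻ x, ∫⁻ y, K (x, y) := by
          refine lintegral_congr fun x => ?_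
          exact (lintegral_const_mul _ (by fun_prop)).symm
      _ ≤ ∫⁻ x, ∫⁻ y, (A.indicator K (x, y) + B.indicator K (x, y)) :=
          lintegral_mono fun x => lintegral_mono fun y => hle (x, y)
      _ = (∫⁻ x, ∫⁻ y, A.indicator K (x, y)) + ∫⁻ x, ∫⁻ y, B.indicator K (x, y) := by
          rw [← lintegral_add_left ((hKm.indicator hA).lintegral_prod_right')]
          refine lintegral_congr fun x => ?_
          exact lintegral_add_left ((hKm.indicator hA).comp measurable_prodMk_left) _
      _ ≤ C + C := add_le_add hAi hBi
  -- A nonzero constant makes the right side infinite when one norm is infinite and the other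
  -- nonzero; otherwise normalise both norms to 1.
  refine ⟨1 + (C + C), by simp [hC], fun f h hf hh => ?_⟩
  set F := (∫⁻ x, f x ^ (4 / 3 : ℝ)) ^ (3 / 4 : ℝ) with hF
  set H := (∫⁻ x, h x ^ (4 / 3 : ℝ)) ^ (3 / 4 : ℝ) with hH
  have vanish : ∀ g : Plane → ℝ≥0∞, Measurable g →
      (∫⁻ x, g x ^ (4 / 3 : ℝ)) ^ (3 / 4 : ℝ) = 0 → g =ᵐ[volume] 0 := by
    intro g hg h0
    rw [ENNReal.rpow_eq_zero_iff_of_pos (by norm_num), lintegral_eq_zero_iff (by fun_prop)] at h0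
    filter_upwards [h0] with x hx
    exact (ENNReal.rpow_eq_zero_iff_of_pos (by norm_num)).1 hx
  rcases eq_or_ne F 0 with hF0 | hF0
  · refine le_of_eq_of_le ?_ zero_le
    refine (lintegral_congr_ae ?_).trans lintegral_zero
    filter_upwards [vanish f hf hF0] with x hx
    simp [hx]
  rcases eq_or_ne H 0 with hH0 | hH0
  · refine le_of_eq_of_le ?_ zero_le
    refine (lintegral_congr fun x => ?_).trans lintegral_zero
    have : ∫⁻ y, h y * ‖x - y‖ₑ⁻¹ = 0 := by
      refine (lintegral_congr_ae ?_).trans lintegral_zero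
      filter_upwards [vanish h hh hH0] with y hy
      simp [hy]
    rw [this, mul_zero]
  rcases eq_or_ne F ⊤ with hFt | hFt
  · rw [hFt, ENNReal.top_mul hH0, ENNReal.mul_top (by simp)]; exact le_top
  rcases eq_or_ne H ⊤ with hHt | hHt
  · rw [hHt, ENNReal.mul_top hF0, ENNReal.mul_top (by simp)]; exact le_top
  have scale : ∀ (g : Plane → ℝ≥0∞) (N : ℝ≥0∞), N = (∫⁻ x, g x ^ (4 / 3 : ℝ)) ^ (3 / 4 : ℝ) →
      N ≠ 0 → N ≠ ⊤ → ∫⁻ x, (N⁻¹ * g x) ^ (4 / 3 : ℝ) ≤ 1 := by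
    intro g N hN hN0 hNt
    have e : ∫⁻ x, g x ^ (4 / 3 : ℝ) = N ^ (4 / 3 : ℝ) := by
      rw [hN, ← ENNReal.rpow_mul]; norm_num
    simp only [ENNReal.mul_rpow_of_nonneg _ _ (show (0 : ℝ) ≤ 4 / 3 by norm_num)]
    rw [lintegral_const_mul' _ _ (ENNReal.rpow_ne_top_of_nonneg (by norm_num) (by simpa)), e,
      ← ENNReal.mul_rpow_of_nonneg _ _ (by norm_num), ENNReal.inv_mul_cancel hN0 hNt,
      ENNReal.one_rpow]
  have key := norm_one (fun x => F⁻¹ * f x) (fun x => H⁻¹ * h x) (by fun_prop) (by fun_prop)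
    (scale f F hF hF0 hFt) (scale h H hH hH0 hHt)
  calc ∫⁻ x, f x * ∫⁻ y, h y * ‖x - y‖ₑ⁻¹
      = ∫⁻ x, F * H * (F⁻¹ * f x * ∫⁻ y, H⁻¹ * h y * ‖x - y‖ₑ⁻¹) := by
        refine lintegral_congr fun x => ?_
        simp only [mul_assoc]
        rw [lintegral_const_mul' _ _ (by simpa)]
        calc f x * ∫⁻ y, h y * ‖x - y‖ₑ⁻¹
            = (F * F⁻¹) * (H * H⁻¹) * (f x * ∫⁻ y, h y * ‖x - y‖ₑ⁻¹) := by
              rw [ENNReal.mul_inv_cancel hF0 hFt, ENNReal.mul_inv_cancel hH0 hHt]; simp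
          _ = _ := by ring
    _ = F * H * ∫⁻ x, F⁻¹ * f x * ∫⁻ y, H⁻¹ * h y * ‖x - y‖ₑ⁻¹ :=
        lintegral_const_mul' _ _ (ENNReal.mul_ne_top hFt hHt)
    _ ≤ F * H * (1 + (C + C)) := by
        gcongr
        exact key.trans le_add_self
    _ = _ := mul_comm _ _

/-! ### The gradient of the heat kernel in `L^{4/3}`. -/

theorem norm43_eq (f : Plane → ℝ) :
    norm43 f = (∫⁻ x, ‖f x‖ₑ ^ (4 / 3 : ℝ)) ^ (3 / 4 : ℝ) := by
  have h : ((4 / 3 : ℝ≥0∞)).toReal = 4 / 3 := by simp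
  rw [norm43, eLpNorm_eq_lintegral_rpow_enorm_toReal (by simp) (by finiteness), h]
  norm_num

/-- The vector field `G(z,s) z / (2s) = -∇G(z,s)`. -/
noncomputable def heatFlux (s : ℝ) (z : Plane) : Plane := (heatKernel s z / (2 * s)) • z

theorem gradient_heatKernel_sub (s : ℝ) (x y : Plane) :
    gradient (fun y : Plane => heatKernel s (x - y)) y = heatFlux s (x - y) := by
  apply HasGradientAt.gradient
  rw [hasGradientAt_iff_hasFDerivAt]
  have h1 : HasFDerivAt (fun y : Plane => x - y) (-ContinuousLinearMap.id ℝ Plane) y :=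
    (hasFDerivAt_id y).const_sub x
  have h2 := (((h1.norm_sq.mul_const (4 * s)⁻¹).neg).exp).const_mul (1 / (4 * Real.pi * s))
  have h3 : (fun y : Plane => heatKernel s (x - y)) =
      fun y => 1 / (4 * Real.pi * s) * Real.exp (-(‖x - y‖ ^ 2 * (4 * s)⁻¹)) := by
    funext y; simp [heatKernel, div_eq_mul_inv]
  rw [h3]
  refine h2.congr_fderiv ?_
  ext w
  simp only [heatFlux, heatKernel, smul_apply, neg_apply,
    ContinuousLinearMap.comp_apply, innerSL_apply_apply, ContinuousLinearMap.id_apply, smul_eq_mul,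
    inner_neg_right, InnerProductSpace.toDual_apply_apply, real_inner_smul_left, nsmul_eq_mul,
    div_eq_mul_inv, mul_inv, Pi.neg_apply]
  push_cast
  ring

/-- The bound `e^x ≥ 1 + x + x²/2` at `x = r²/4` already grows like `r⁴`, the degree of `r (1 +
r)³`. -/
theorem mul_one_add_pow_mul_exp_le (r : ℝ) :
    r * (1 + r) ^ 3 * Real.exp (-(r ^ 2 / 4)) ≤ 256 := by
  have h := Real.quadratic_le_exp_of_nonneg (show 0 ≤ r ^ 2 / 4 by positivity)
  rw [Real.exp_neg, ← div_eq_mul_inv, div_le_iff₀ (Real.exp_pos _)]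
  nlinarith [sq_nonneg (r - 1), sq_nonneg (r ^ 2 - 1), sq_nonneg (r ^ 2 - r), sq_nonneg (r + 1)]

/-- Cubic decay in the variable `z/√s` is all that is kept of the Gaussian: its power `4/3` is `(1 +
r)^{-4}`, integrable on the plane. -/
theorem norm_heatFlux_le {s : ℝ} (hs : 0 < s) (z : Plane) :
    ‖heatFlux s z‖ ≤ 256 * s ^ (-(3 / 2) : ℝ) * (1 + ‖(√s)⁻¹ • z‖) ^ (-3 : ℝ) := by
  set r : ℝ := ‖(√s)⁻¹ • z‖ with hr
  have hq : 0 < √s := Real.sqrt_pos.2 hs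
  have hz : ‖z‖ = √s * r := by
    rw [hr, norm_smul, norm_inv, Real.norm_of_nonneg hq.le, mul_inv_cancel_left₀ hq.ne']
  have hr0 : 0 ≤ r := norm_nonneg _
  have hsq : √s ^ 2 = s := Real.sq_sqrt hs.le
  have hK : 0 ≤ heatKernel s z := by unfold heatKernel; positivity
  have hs32 : s ^ (-(3 / 2) : ℝ) = √s / s ^ 2 := by
    rw [Real.sqrt_eq_rpow, ← Real.rpow_natCast, ← Real.rpow_sub hs]; norm_num
  have h3 : (1 + r) ^ (-3 : ℝ) = ((1 + r) ^ 3)⁻¹ := by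
    rw [Real.rpow_neg (by positivity)]; norm_cast
  rw [heatFlux, norm_smul, Real.norm_of_nonneg (by positivity), hs32, h3, hz, heatKernel, hz]
  have he : (√s * r) ^ 2 / (4 * s) = r ^ 2 / 4 := by
    rw [mul_pow, hsq]; field_simp
  rw [he, ← div_eq_mul_inv, le_div_iff₀ (by positivity)]
  have hb := mul_one_add_pow_mul_exp_le r
  have hpi : 1 / (8 * Real.pi) ≤ 1 := by
    rw [div_le_one (by positivity)]; linarith [Real.pi_gt_three]
  have hb' : 1 / (8 * Real.pi) * (r * (1 + r) ^ 3 * Real.exp (-(r ^ 2 / 4))) ≤ 1 * 256 :=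
    mul_le_mul hpi hb (by positivity) (by norm_num)
  calc _ = √s / s ^ 2 * (1 / (8 * Real.pi) * (r * (1 + r) ^ 3 * Real.exp (-(r ^ 2 / 4)))) := by
        field_simp; ring
    _ ≤ √s / s ^ 2 * (1 * 256) := by gcongr
    _ = _ := by ring

/-- `‖∇G(·,s)‖_{4/3} ≤ C s^{-3/4}`. -/
theorem exists_lintegral_heatFlux_le :
    ∃ C : ℝ≥0∞, C ≠ ⊤ ∧ C ≠ 0 ∧ ∀ s : ℝ, 0 < s → ∀ y : Plane,
      ∫⁻ x, ‖heatFlux s (x - y)‖ₑ ^ (4 / 3 : ℝ)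
        ≤ (C * ENNReal.ofReal (s ^ (-(3 / 4) : ℝ))) ^ (4 / 3 : ℝ) := by
  set J := ∫⁻ z : Plane, ENNReal.ofReal ((1 + ‖z‖) ^ (-4 : ℝ)) with hJ
  have hJt : J < ⊤ := finite_integral_one_add_norm (E := Plane) (μ := volume) (by simp; norm_num)
  -- The summand 1 ensures `C ≠ 0`, required of the weight in Minkowski's inequality.
  refine ⟨1 + 256 * J ^ (3 / 4 : ℝ), ?_, by simp, fun s hs y => ?_⟩
  · exact ENNReal.add_ne_top.2 ⟨by simp, ENNReal.mul_ne_top (by simp)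
      (ENNReal.rpow_ne_top_of_nonneg (by norm_num) hJt.ne)⟩
  have hq : 0 < √s := Real.sqrt_pos.2 hs
  have hpt : ∀ z, ‖heatFlux s z‖ₑ ^ (4 / 3 : ℝ) ≤ ENNReal.ofReal ((256 : ℝ) ^ (4 / 3 : ℝ)
      * s ^ (-2 : ℝ)) * ENNReal.ofReal ((1 + ‖(√s)⁻¹ • z‖) ^ (-4 : ℝ)) := by
    intro z
    rw [← ENNReal.ofReal_mul (by positivity), ← ofReal_norm,
      ENNReal.ofReal_rpow_of_nonneg (norm_nonneg _) (by norm_num)]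
    apply ENNReal.ofReal_le_ofReal
    calc _ ≤ (256 * s ^ (-(3 / 2) : ℝ) * (1 + ‖(√s)⁻¹ • z‖) ^ (-3 : ℝ)) ^ (4 / 3 : ℝ) :=
          Real.rpow_le_rpow (norm_nonneg _) (norm_heatFlux_le hs z) (by norm_num)
      _ = _ := by
          rw [Real.mul_rpow (by positivity) (by positivity),
            Real.mul_rpow (by positivity) (by positivity), ← Real.rpow_mul hs.le,
            ← Real.rpow_mul (by positivity)]
          norm_num
  calc ∫⁻ x, ‖heatFlux s (x - y)‖ₑ ^ (4 / 3 : ℝ)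
      = ∫⁻ z, ‖heatFlux s z‖ₑ ^ (4 / 3 : ℝ) :=
        lintegral_sub_right_eq_self (fun z => ‖heatFlux s z‖ₑ ^ (4 / 3 : ℝ)) y
    _ ≤ _ := lintegral_mono hpt
    _ = ENNReal.ofReal ((256 : ℝ) ^ (4 / 3 : ℝ) * s ^ (-2 : ℝ)) * (ENNReal.ofReal s * J) := by
        rw [lintegral_const_mul' _ _ ENNReal.ofReal_ne_top,
          lintegral_comp_inv_smul (fun z => ENNReal.ofReal ((1 + ‖z‖) ^ (-4 : ℝ))) hq,
          Real.sq_sqrt hs.le]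
    _ = (256 * J ^ (3 / 4 : ℝ) * ENNReal.ofReal (s ^ (-(3 / 4) : ℝ))) ^ (4 / 3 : ℝ) := by
        rw [ENNReal.mul_rpow_of_nonneg _ _ (by norm_num),
          ENNReal.mul_rpow_of_nonneg _ _ (by norm_num), ← ENNReal.rpow_mul,
          ENNReal.ofReal_rpow_of_pos (by positivity), ← Real.rpow_mul hs.le,
          ENNReal.ofReal_mul (by positivity), ← ENNReal.ofReal_rpow_of_pos (by norm_num)]
        have e : ENNReal.ofReal (s ^ (-2 : ℝ)) * ENNReal.ofReal s
            = ENNReal.ofReal (s ^ (-(3 / 4) * (4 / 3) : ℝ)) := by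
          rw [← ENNReal.ofReal_mul (by positivity)]
          congr 1
          nth_rw 2 [← Real.rpow_one s]
          rw [← Real.rpow_add hs]; norm_num
        rw [← e]
        norm_num
        ring
    _ ≤ _ := by
        gcongr
        exact le_add_self

/-! ### Riesz potentials and the nonlinear flux. -/

/-- Away from 0 the gradient is `x / (2π|x|²)`, found by writing `log |x|` as half of `log |x|²`; at
0 the right side is `⊤`. -/
theorem enorm_gradient_fundamentalSol_le (x : Plane) :
    ‖gradient fundamentalSol x‖ₑ ≤ ‖x‖ₑ⁻¹ := by
  rcases eq_or_ne x 0 with rfl | hx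
  · simp
  have hn : 0 < ‖x‖ := norm_pos_iff.2 hx
  have hg : HasGradientAt fundamentalSol ((1 / (2 * Real.pi * ‖x‖ ^ 2)) • x) x := by
    rw [hasGradientAt_iff_hasFDerivAt]
    have h1 := (((hasFDerivAt_id x).norm_sq.log (by simpa using hx)).const_mul (1 / (4 * Real.pi)))
    have h2 : fundamentalSol = fun x : Plane => 1 / (4 * Real.pi) * Real.log (‖id x‖ ^ 2) := by
      funext x
      rw [fundamentalSol, Real.log_pow, id]
      push_cast
      ring
    rw [h2]
    refine h1.congr_fderiv ?_
    ext w
    simp only [smul_apply, ContinuousLinearMap.comp_apply, innerSL_apply_apply,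
      ContinuousLinearMap.id_apply, smul_eq_mul, InnerProductSpace.toDual_apply_apply,
      real_inner_smul_left, nsmul_eq_mul, id]
    push_cast
    field_simp
    ring
  rw [hg.gradient, ← ofReal_norm, ← ofReal_norm, ← ENNReal.ofReal_inv_of_pos hn]
  apply ENNReal.ofReal_le_ofReal
  rw [norm_smul, Real.norm_of_nonneg (by positivity)]
  have : 1 / (2 * Real.pi * ‖x‖ ^ 2) * ‖x‖ = 1 / (2 * Real.pi) * ‖x‖⁻¹ := by field_simp
  rw [this]
  refine mul_le_of_le_one_left (by positivity) ?_
  rw [div_le_one (by positivity)]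
  linarith [Real.pi_gt_three]

theorem measurable_gradient_fundamentalSol : Measurable (gradient fundamentalSol) :=
  ((InnerProductSpace.toDual ℝ Plane).symm.continuous.measurable).comp
    (measurable_fderiv ℝ fundamentalSol)

/-- The Riesz potential `∫ |v(z)| / |y - z| dz`. -/
noncomputable def rieszPotential (v : Plane → ℝ) (y : Plane) : ℝ≥0∞ :=
  ∫⁻ z, ‖v z‖ₑ * ‖y - z‖ₑ⁻¹

theorem measurable_rieszPotential {α : Type*} [MeasurableSpace α] {V : α × Plane → ℝ}
    (hV : Measurable V) :
    Measurable fun p : α × Plane => rieszPotential (fun z => V (p.1, z)) p.2 := by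
  unfold rieszPotential
  have : Measurable fun q : (α × Plane) × Plane => ‖V (q.1.1, q.2)‖ₑ * ‖q.1.2 - q.2‖ₑ⁻¹ := by
    fun_prop
  exact this.lintegral_prod_right'

theorem measurable_gradPotential {α : Type*} [MeasurableSpace α] {V : α × Plane → ℝ}
    (hV : Measurable V) :
    Measurable fun p : α × Plane => gradPotential (fun z => V (p.1, z)) p.2 := by
  unfold gradPotential
  have hg := measurable_gradient_fundamentalSol
  have : Measurable fun q : (α × Plane) × Plane =>
      V (q.1.1, q.2) • gradient fundamentalSol (q.1.2 - q.2) := by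
    fun_prop
  exact (this.stronglyMeasurable.integral_prod_right').neg.measurable

theorem measurable_rieszPotential_const {v : Plane → ℝ} (hv : Measurable v) :
    Measurable (rieszPotential v) := by
  unfold rieszPotential
  have : Measurable fun q : Plane × Plane => ‖v q.2‖ₑ * ‖q.1 - q.2‖ₑ⁻¹ := by fun_prop
  exact this.lintegral_prod_right'

theorem measurable_gradPotential_const {v : Plane → ℝ} (hv : Measurable v) :
    Measurable (gradPotential v) := by
  unfold gradPotential
  have hg := measurable_gradient_fundamentalSol
  have : Measurable fun q : Plane × Plane => v q.2 • gradient fundamentalSol (q.1 - q.2) := by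
    fun_prop
  exact (this.stronglyMeasurable.integral_prod_right').neg.measurable

theorem measurable_heatFlux_comp {α : Type*} [MeasurableSpace α] {a : α → ℝ} {b : α → Plane}
    (ha : Measurable a) (hb : Measurable b) : Measurable fun q => heatFlux (a q) (b q) := by
  unfold heatFlux heatKernel
  fun_prop

theorem heatB_eq (s : ℝ) (u v : Plane → ℝ) (x : Plane) :
    heatB s u v x = -∫ y, u y * inner ℝ (gradPotential v y) (heatFlux s (x - y)) := by
  simp only [heatB, bilinearB, gradient_heatKernel_sub]

theorem heatB_congr {u u' : Plane → ℝ} (h : u =ᵐ[volume] u') (s : ℝ) (x : Plane) :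
    heatB s u u x = heatB s u' u' x := by
  have hg : gradPotential u = gradPotential u' := by
    funext y
    unfold gradPotential
    congr 1
    refine integral_congr_ae ?_
    filter_upwards [h] with z hz
    rw [hz]
  rw [heatB_eq, heatB_eq, hg]
  congr 1
  refine integral_congr_ae ?_
  filter_upwards [h] with z hz
  rw [hz]

theorem measurable_heatB {U : ℝ × Plane → ℝ} (hU : Measurable U) (t : ℝ) :
    Measurable fun p : ℝ × Plane =>
      heatB (t - p.1) (fun y => U (p.1, y)) (fun y => U (p.1, y)) p.2 := by
  simp only [heatB_eq]
  have hG := measurable_gradPotential hU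
  have h1 : Measurable fun q : (ℝ × Plane) × Plane =>
      gradPotential (fun z => U (q.1.1, z)) q.2 :=
    hG.comp (measurable_fst.fst.prodMk measurable_snd)
  have h2 : Measurable fun q : (ℝ × Plane) × Plane => heatFlux (t - q.1.1) (q.1.2 - q.2) :=
    measurable_heatFlux_comp (by fun_prop) (by fun_prop)
  have h3 : Measurable fun q : (ℝ × Plane) × Plane => U (q.1.1, q.2) *
      inner ℝ (gradPotential (fun z => U (q.1.1, z)) q.2) (heatFlux (t - q.1.1) (q.1.2 - q.2)) := by
    fun_prop
  exact (h3.stronglyMeasurable.integral_prod_right').neg.measurable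

theorem enorm_inner_le (a b : Plane) : ‖inner ℝ a b‖ₑ ≤ ‖a‖ₑ * ‖b‖ₑ := by
  rw [← ofReal_norm, ← ofReal_norm, ← ofReal_norm, ← ENNReal.ofReal_mul (norm_nonneg _)]
  exact ENNReal.ofReal_le_ofReal (norm_inner_le_norm a b)

theorem enorm_gradPotential_le (v : Plane → ℝ) (y : Plane) :
    ‖gradPotential v y‖ₑ ≤ rieszPotential v y := by
  rw [gradPotential, enorm_neg]
  refine (enorm_integral_le_lintegral_enorm _).trans (lintegral_mono fun z => ?_)
  rw [enorm_smul]
  gcongr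
  exact enorm_gradient_fundamentalSol_le _

/-- `enorm_integral_sub_integral_le` covers also the points `y` where the integrals defining the
potentials diverge. -/
theorem enorm_gradPotential_sub_le {u v : Plane → ℝ} (hu : Measurable u) (hv : Measurable v)
    (y : Plane) :
    ‖gradPotential u y - gradPotential v y‖ₑ ≤ rieszPotential (fun z => u z - v z) y := by
  have hg := measurable_gradient_fundamentalSol
  rw [gradPotential, gradPotential, neg_sub_neg, ← enorm_neg, neg_sub]
  refine (enorm_integral_sub_integral_le (Measurable.aestronglyMeasurable (by fun_prop))
    (Measurable.aestronglyMeasurable (by fun_prop))).trans (lintegral_mono fun z => ?_)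
  simp only
  rw [← sub_smul, enorm_smul]
  gcongr
  exact enorm_gradient_fundamentalSol_le _

/-- The majorant `|u - v| I(|u|) + |v| I(|u - v|)` of the difference of the two nonlinear fluxes,
`I` being the Riesz potential. -/
noncomputable def fluxMajorant (u v : Plane → ℝ) (y : Plane) : ℝ≥0∞ :=
  ‖u y - v y‖ₑ * rieszPotential u y + ‖v y‖ₑ * rieszPotential (fun z => u z - v z) y

theorem measurable_fluxMajorant {U V : ℝ × Plane → ℝ} (hU : Measurable U) (hV : Measurable V) :
    Measurable fun p : ℝ × Plane =>
      fluxMajorant (fun y => U (p.1, y)) (fun y => V (p.1, y)) p.2 := by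
  unfold fluxMajorant
  have h1 := measurable_rieszPotential hU
  have h2 := measurable_rieszPotential (hU.sub hV)
  simp only [Pi.sub_apply] at h2
  fun_prop

/-- Bilinear splitting `u∇φ_u - v∇φ_v = (u - v)∇φ_u + v(∇φ_u - ∇φ_v)`. -/
theorem enorm_heatB_sub_le {u v : Plane → ℝ} (hu : Measurable u) (hv : Measurable v) (s : ℝ)
    (x : Plane) :
    ‖heatB s u u x - heatB s v v x‖ₑ
      ≤ ∫⁻ y, ‖heatFlux s (x - y)‖ₑ * fluxMajorant u v y := by
  have hGu := measurable_gradPotential_const hu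
  have hGv := measurable_gradPotential_const hv
  have hF : Measurable fun y => heatFlux s (x - y) :=
    measurable_heatFlux_comp measurable_const (by fun_prop)
  rw [heatB_eq, heatB_eq, neg_sub_neg, ← enorm_neg, neg_sub]
  refine (enorm_integral_sub_integral_le (Measurable.aestronglyMeasurable (by fun_prop))
    (Measurable.aestronglyMeasurable (by fun_prop))).trans (lintegral_mono fun y => ?_)
  have e : u y * inner ℝ (gradPotential u y) (heatFlux s (x - y))
      - v y * inner ℝ (gradPotential v y) (heatFlux s (x - y))
      = (u y - v y) * inner ℝ (gradPotential u y) (heatFlux s (x - y))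
        + v y * inner ℝ (gradPotential u y - gradPotential v y) (heatFlux s (x - y)) := by
    rw [inner_sub_left]; ring
  simp only
  rw [e]
  calc _ ≤ ‖u y - v y‖ₑ * (‖gradPotential u y‖ₑ * ‖heatFlux s (x - y)‖ₑ)
        + ‖v y‖ₑ * (‖gradPotential u y - gradPotential v y‖ₑ * ‖heatFlux s (x - y)‖ₑ) := by
        refine (enorm_add_le _ _).trans ?_
        rw [enorm_mul, enorm_mul]
        gcongr <;> exact enorm_inner_le _ _
    _ ≤ ‖u y - v y‖ₑ * (rieszPotential u y * ‖heatFlux s (x - y)‖ₑ)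
        + ‖v y‖ₑ * (rieszPotential (fun z => u z - v z) y * ‖heatFlux s (x - y)‖ₑ) := by
        gcongr
        · exact enorm_gradPotential_le u y
        · exact enorm_gradPotential_sub_le hu hv y
    _ = _ := by rw [fluxMajorant]; ring

/-- Hardy–Littlewood–Sobolev applied to each of the two products; the exponents match since `3/4 +
3/4 + 1/2 = 2`. -/
theorem exists_lintegral_fluxMajorant_le :
    ∃ C : ℝ≥0∞, C ≠ ⊤ ∧ ∀ u v : Plane → ℝ, Measurable u → Measurable v →
      ∫⁻ y, fluxMajorant u v y ≤ C * (norm43 (u - v) * (norm43 u + norm43 v)) := by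
  obtain ⟨C, hC, hCb⟩ := exists_hardyLittlewoodSobolev
  have hb : ∀ f h : Plane → ℝ, Measurable f → Measurable h →
      ∫⁻ y, ‖f y‖ₑ * rieszPotential h y ≤ C * (norm43 f * norm43 h) := by
    intro f h hf hh
    rw [norm43_eq, norm43_eq]
    exact hCb (fun y => ‖f y‖ₑ) (fun y => ‖h y‖ₑ) (by fun_prop) (by fun_prop)
  refine ⟨C, hC, fun u v hu hv => ?_⟩
  have hR := measurable_rieszPotential_const hu
  calc ∫⁻ y, fluxMajorant u v y = (∫⁻ y, ‖(u - v) y‖ₑ * rieszPotential u y)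
        + ∫⁻ y, ‖v y‖ₑ * rieszPotential (u - v) y :=
        lintegral_add_left (by fun_prop) _
    _ ≤ C * (norm43 (u - v) * norm43 u) + C * (norm43 v * norm43 (u - v)) :=
        add_le_add (hb _ _ (hu.sub hv) hu) (hb _ _ hv (hu.sub hv))
    _ = _ := by ring

/-! ### The Duhamel term in `L^{4/3}`. -/

/-- The nonlinear term of the mild formulation. -/
noncomputable def duhamelTerm (u : ℝ → Plane → ℝ) (t : ℝ) (x : Plane) : ℝ :=
  ∫ τ in (0 : ℝ)..t, heatB (t - τ) (u τ) (u τ) x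

theorem measurable_duhamelTerm {U : ℝ × Plane → ℝ} (hU : Measurable U) {t : ℝ} (ht : 0 ≤ t) :
    Measurable (duhamelTerm (fun τ y => U (τ, y)) t) := by
  unfold duhamelTerm
  simp only [intervalIntegral.integral_of_le ht]
  have h : Measurable fun q : Plane × ℝ =>
      heatB (t - q.2) (fun y => U (q.2, y)) (fun y => U (q.2, y)) q.1 :=
    (measurable_heatB hU t).comp measurable_swap
  exact (h.stronglyMeasurable.integral_prod_right' (ν := volume.restrict (Ioc 0 t))).measurable

theorem enorm_duhamelTerm_sub_le {U V : ℝ × Plane → ℝ} (hU : Measurable U) (hV : Measurable V)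
    {t : ℝ} (ht : 0 ≤ t) (x : Plane) :
    ‖duhamelTerm (fun τ y => U (τ, y)) t x - duhamelTerm (fun τ y => V (τ, y)) t x‖ₑ
      ≤ ∫⁻ z : ℝ × Plane, ‖heatFlux (t - z.1) (x - z.2)‖ₑ
          * fluxMajorant (fun y => U (z.1, y)) (fun y => V (z.1, y)) z.2
          ∂((volume.restrict (Ioo 0 t)).prod volume) := by
  have hm : ∀ {W : ℝ × Plane → ℝ}, Measurable W → Measurable fun τ =>
      heatB (t - τ) (fun y => W (τ, y)) (fun y => W (τ, y)) x := fun hW =>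
    (measurable_heatB hW t).comp measurable_prodMk_right
  have hF : Measurable fun z : ℝ × Plane => heatFlux (t - z.1) (x - z.2) :=
    measurable_heatFlux_comp (by fun_prop) (by fun_prop)
  have hM := measurable_fluxMajorant hU hV
  rw [lintegral_prod _ (by fun_prop)]
  simp only [duhamelTerm, intervalIntegral.integral_of_le ht]
  rw [setLIntegral_congr Ioo_ae_eq_Ioc]
  refine (enorm_integral_sub_integral_le (hm hU).aestronglyMeasurable
    (hm hV).aestronglyMeasurable).trans (lintegral_mono fun τ => ?_)
  exact enorm_heatB_sub_le (by fun_prop) (by fun_prop) _ _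

/-- Minkowski's inequality over `z = (τ, y)`: the norm in `x` of `∇G(x - y, t - τ)` has a bound `c`
independent of `y`, so only the `L¹` norm of the flux majorant in `y` remains. -/
theorem exists_norm43_duhamelTerm_sub_le_of_measurable :
    ∃ C : ℝ≥0∞, C ≠ ⊤ ∧ ∀ U V : ℝ × Plane → ℝ, Measurable U → Measurable V → ∀ t : ℝ, 0 < t →
      norm43 (duhamelTerm (fun τ y => U (τ, y)) t - duhamelTerm (fun τ y => V (τ, y)) t)
        ≤ C * ∫⁻ τ in Ioo 0 t, ENNReal.ofReal ((t - τ) ^ (-(3 / 4) : ℝ)) *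
          (norm43 ((fun y => U (τ, y)) - fun y => V (τ, y))
            * (norm43 (fun y => U (τ, y)) + norm43 fun y => V (τ, y))) := by
  obtain ⟨C₁, h1t, h10, hC₁⟩ := exists_lintegral_heatFlux_le
  obtain ⟨C₂, h2t, hC₂⟩ := exists_lintegral_fluxMajorant_le
  refine ⟨C₁ * C₂, ENNReal.mul_ne_top h1t h2t, fun U V hU hV t ht => ?_⟩
  have hM := measurable_fluxMajorant hU hV
  set M : ℝ × Plane → ℝ≥0∞ := fun z => fluxMajorant (fun y => U (z.1, y)) (fun y => V (z.1, y)) z.2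
    with hMdef
  set ν : Measure (ℝ × Plane) := (volume.restrict (Ioo 0 t)).prod volume with hν
  set c : ℝ × Plane → ℝ≥0∞ := fun z => C₁ * ENNReal.ofReal ((t - z.1) ^ (-(3 / 4) : ℝ)) with hc
  have hmem : ∀ᵐ z : ℝ × Plane ∂ν, z.1 ∈ Ioo 0 t :=
    Measure.quasiMeasurePreserving_fst.ae (ae_restrict_mem measurableSet_Ioo)
  have hpq : (4 / 3 : ℝ).HolderConjugate 4 := by
    rw [Real.holderConjugate_iff]; norm_num
  have hk : Measurable (Function.uncurry fun (x : Plane) (z : ℝ × Plane) =>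
      ‖heatFlux (t - z.1) (x - z.2)‖ₑ) :=
    (measurable_heatFlux_comp (α := Plane × (ℝ × Plane)) (a := fun q => t - q.2.1)
      (b := fun q => q.1 - q.2.2) (by fun_prop) (by fun_prop)).enorm
  have hmink := lintegral_lintegral_mul_rpow_le (μ := volume) (ν := ν) hpq hk
    (c := c) (F := M) (by fun_prop) hM
    (by
      filter_upwards [hmem] with z hz
      have : 0 < (t - z.1) ^ (-(3 / 4) : ℝ) := Real.rpow_pos_of_pos (by linarith [hz.2]) _
      simp [hc, h10, this])
    (Eventually.of_forall fun z => ENNReal.mul_ne_top h1t ENNReal.ofReal_ne_top)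
    (by
      filter_upwards [hmem] with z hz
      exact hC₁ _ (by linarith [hz.2]) _)
  calc norm43 _ ≤ (∫⁻ x, (∫⁻ z, ‖heatFlux (t - z.1) (x - z.2)‖ₑ * M z ∂ν) ^ (4 / 3 : ℝ))
        ^ (3 / 4 : ℝ) := by
        rw [norm43_eq]
        gcongr with x
        exact enorm_duhamelTerm_sub_le hU hV ht.le x
    _ ≤ ((∫⁻ z, c z * M z ∂ν) ^ (4 / 3 : ℝ)) ^ (3 / 4 : ℝ) := by gcongr
    _ = ∫⁻ z, c z * M z ∂ν := by rw [← ENNReal.rpow_mul]; norm_num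
    _ = ∫⁻ τ in Ioo 0 t, ∫⁻ y, c (τ, y) * M (τ, y) := lintegral_prod _ (by fun_prop)
    _ ≤ ∫⁻ τ in Ioo 0 t, (C₁ * C₂) * (ENNReal.ofReal ((t - τ) ^ (-(3 / 4) : ℝ)) *
          (norm43 ((fun y => U (τ, y)) - fun y => V (τ, y))
            * (norm43 (fun y => U (τ, y)) + norm43 fun y => V (τ, y)))) := by
        refine lintegral_mono fun τ => ?_
        simp only [hc]
        rw [lintegral_const_mul' _ _ (ENNReal.mul_ne_top h1t ENNReal.ofReal_ne_top)]
        calc _ ≤ C₁ * ENNReal.ofReal ((t - τ) ^ (-(3 / 4) : ℝ)) * (C₂ *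
              (norm43 ((fun y => U (τ, y)) - fun y => V (τ, y))
                * (norm43 (fun y => U (τ, y)) + norm43 fun y => V (τ, y)))) := by
              gcongr
              exact hC₂ _ _ (by fun_prop) (by fun_prop)
          _ = _ := by ring
    _ = _ := lintegral_const_mul' _ _ (ENNReal.mul_ne_top h1t h2t)

/-- A measurable representative of a time-dependent function. -/
theorem exists_measurable_representative {u : ℝ → Plane → ℝ}
    (hu : AEStronglyMeasurable (Function.uncurry u) ((volume.restrict (Ioi (0 : ℝ))).prod volume)) :
    ∃ U : ℝ × Plane → ℝ, Measurable U ∧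
      ∀ᵐ τ ∂(volume.restrict (Ioi (0 : ℝ))), u τ =ᵐ[volume] fun y => U (τ, y) :=
  ⟨hu.mk, hu.stronglyMeasurable_mk.measurable, Measure.ae_ae_of_ae_prod hu.ae_eq_mk⟩

theorem duhamelTerm_congr {u u' : ℝ → Plane → ℝ}
    (h : ∀ᵐ τ ∂(volume.restrict (Ioi (0 : ℝ))), u τ =ᵐ[volume] u' τ) {t : ℝ} (ht : 0 ≤ t) :
    duhamelTerm u t = duhamelTerm u' t := by
  funext x
  simp only [duhamelTerm, intervalIntegral.integral_of_le ht]
  refine integral_congr_ae ?_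
  filter_upwards [ae_restrict_of_ae_restrict_of_subset Ioc_subset_Ioi_self h] with τ hτ
  exact heatB_congr hτ _ _

theorem aestronglyMeasurable_duhamelTerm {u : ℝ → Plane → ℝ}
    (hu : AEStronglyMeasurable (Function.uncurry u) ((volume.restrict (Ioi (0 : ℝ))).prod volume))
    {t : ℝ} (ht : 0 ≤ t) : AEStronglyMeasurable (duhamelTerm u t) volume := by
  obtain ⟨U, hU, huU⟩ := exists_measurable_representative hu
  rw [duhamelTerm_congr huU ht]
  exact (measurable_duhamelTerm hU ht).aestronglyMeasurable

/-- Both sides see `u` and `v` only through integrals in `τ` and classes in `y`, so measurable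
representatives suffice. -/
theorem exists_norm43_duhamelTerm_sub_le :
    ∃ C : ℝ≥0∞, C ≠ ⊤ ∧ ∀ u v : ℝ → Plane → ℝ,
      AEStronglyMeasurable (Function.uncurry u) ((volume.restrict (Ioi (0 : ℝ))).prod volume) →
      AEStronglyMeasurable (Function.uncurry v) ((volume.restrict (Ioi (0 : ℝ))).prod volume) →
      ∀ t : ℝ, 0 < t → norm43 (duhamelTerm u t - duhamelTerm v t)
        ≤ C * ∫⁻ τ in Ioo 0 t, ENNReal.ofReal ((t - τ) ^ (-(3 / 4) : ℝ)) *
          (norm43 (u τ - v τ) * (norm43 (u τ) + norm43 (v τ))) := by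
  obtain ⟨C, hC, hCb⟩ := exists_norm43_duhamelTerm_sub_le_of_measurable
  refine ⟨C, hC, fun u v hu hv t ht => ?_⟩
  obtain ⟨U, hU, huU⟩ := exists_measurable_representative hu
  obtain ⟨V, hV, hvV⟩ := exists_measurable_representative hv
  rw [duhamelTerm_congr huU ht.le, duhamelTerm_congr hvV ht.le]
  refine (hCb U V hU hV t ht).trans_eq ?_
  congr 1
  refine lintegral_congr_ae ?_
  filter_upwards [ae_restrict_of_ae_restrict_of_subset Ioo_subset_Ioi_self huU,
    ae_restrict_of_ae_restrict_of_subset Ioo_subset_Ioi_self hvV] with τ h1 h2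
  unfold norm43
  rw [eLpNorm_congr_ae h1, eLpNorm_congr_ae h2, eLpNorm_congr_ae (h1.sub h2)]

/-! ### Comparison of two mild solutions. -/

theorem heat_sub {t : ℝ} (ht : 0 < t) (T S : Tempered) : heat t (T - S) = heat t T - heat t S := by
  funext x
  simp [heat, ht]

theorem one_le_four_thirds : (1 : ℝ≥0∞) ≤ 4 / 3 := by
  rw [ENNReal.le_div_iff_mul_le (by simp) (by simp)]
  norm_num

theorem norm43_add_le {f g : Plane → ℝ} (hf : AEStronglyMeasurable f volume)
    (hg : AEStronglyMeasurable g volume) : norm43 (f + g) ≤ norm43 f + norm43 g :=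
  eLpNorm_add_le hf hg one_le_four_thirds

theorem norm43_sub_le {f g : Plane → ℝ} (hf : AEStronglyMeasurable f volume)
    (hg : AEStronglyMeasurable g volume) : norm43 (f - g) ≤ norm43 f + norm43 g :=
  eLpNorm_sub_le hf hg one_le_four_thirds

theorem IsMildSolution.eq_heat_add {u₀ : Tempered} {u : ℝ → Plane → ℝ} (hu : IsMildSolution u₀ u)
    {t : ℝ} (ht : 0 < t) : u t =ᵐ[volume] heat t u₀ + duhamelTerm u t :=
  hu.duhamel t ht

theorem IsMildSolution.aestronglyMeasurable_duhamelTerm {u₀ : Tempered} {u : ℝ → Plane → ℝ}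
    (hu : IsMildSolution u₀ u) {t : ℝ} (ht : 0 < t) :
    AEStronglyMeasurable (duhamelTerm u t) volume :=
  DebyeNernstPlanck.aestronglyMeasurable_duhamelTerm hu.mem.aestronglyMeasurable ht.le

/-- Read off from the mild formula, as `u t` minus the Duhamel term. -/
theorem IsMildSolution.aestronglyMeasurable_heat {u₀ : Tempered} {u : ℝ → Plane → ℝ}
    (hu : IsMildSolution u₀ u) {t : ℝ} (ht : 0 < t) :
    AEStronglyMeasurable (heat t u₀) volume := by
  refine ((hu.mem.memLp t ht).1.sub (hu.aestronglyMeasurable_duhamelTerm ht)).congr ?_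
  filter_upwards [hu.eq_heat_add ht] with x hx
  simp [hx]

theorem norm43_sub_le_heat_add {u₀ v₀ : Tempered} {u v : ℝ → Plane → ℝ}
    (hu : IsMildSolution u₀ u) (hv : IsMildSolution v₀ v) {t : ℝ} (ht : 0 < t) :
    norm43 (u t - v t) ≤ norm43 (heat t (u₀ - v₀)) + norm43 (duhamelTerm u t - duhamelTerm v t) := by
  have h : u t - v t =ᵐ[volume] heat t (u₀ - v₀) + (duhamelTerm u t - duhamelTerm v t) := by
    rw [heat_sub ht]
    filter_upwards [hu.eq_heat_add ht, hv.eq_heat_add ht] with x h1 h2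
    simp only [Pi.sub_apply, Pi.add_apply, h1, h2]
    ring
  rw [norm43, eLpNorm_congr_ae h]
  refine norm43_add_le ?_
    ((hu.aestronglyMeasurable_duhamelTerm ht).sub (hv.aestronglyMeasurable_duhamelTerm ht))
  rw [heat_sub ht]
  exact (hu.aestronglyMeasurable_heat ht).sub (hv.aestronglyMeasurable_heat ht)

theorem norm43_heat_le_sub_add {u₀ v₀ : Tempered} {u v : ℝ → Plane → ℝ}
    (hu : IsMildSolution u₀ u) (hv : IsMildSolution v₀ v) {t : ℝ} (ht : 0 < t) :
    norm43 (heat t (u₀ - v₀)) ≤ norm43 (u t - v t) + norm43 (duhamelTerm u t - duhamelTerm v t) := by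
  have h : heat t (u₀ - v₀) =ᵐ[volume] (u t - v t) - (duhamelTerm u t - duhamelTerm v t) := by
    rw [heat_sub ht]
    filter_upwards [hu.eq_heat_add ht, hv.eq_heat_add ht] with x h1 h2
    simp only [Pi.sub_apply, Pi.add_apply, h1, h2]
    ring
  rw [norm43, eLpNorm_congr_ae h]
  exact norm43_sub_le ((hu.mem.memLp t ht).1.sub (hv.mem.memLp t ht).1)
    ((hu.aestronglyMeasurable_duhamelTerm ht).sub (hv.aestronglyMeasurable_duhamelTerm ht))

theorem le_weightedSup (F : ℝ → Plane → ℝ) {t : ℝ} (ht : 0 < t) :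
    ENNReal.ofReal (t ^ (1 / 4 : ℝ)) * norm43 (F t) ≤ weightedSup F :=
  le_iSup₂ (f := fun (t : ℝ) (_ : 0 < t) => ENNReal.ofReal (t ^ (1 / 4 : ℝ)) * norm43 (F t)) t ht

/-- The factor `τ^{-1/2}` pays for two weights `τ^{1/4}`: one goes to the size of the solutions, the
other to their difference. -/
theorem ofReal_rpow_mul_ofReal_sq {τ : ℝ} (hτ : 0 < τ) :
    ENNReal.ofReal (τ ^ (-(1 / 2) : ℝ)) *
      (ENNReal.ofReal (τ ^ (1 / 4 : ℝ)) * ENNReal.ofReal (τ ^ (1 / 4 : ℝ))) = 1 := by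
  rw [← ENNReal.ofReal_mul (by positivity), ← ENNReal.ofReal_mul (by positivity),
    ← Real.rpow_add hτ, ← Real.rpow_add hτ]
  norm_num

/-- The weighted norm of the difference of the nonlinear terms is at most a small multiple of the
time average of the weighted norm of the difference of the solutions. -/
theorem exists_weighted_duhamelTerm_sub_le :
    ∃ C : ℝ≥0∞, C ≠ ⊤ ∧ ∀ u v : ℝ → Plane → ℝ,
      AEStronglyMeasurable (Function.uncurry u) ((volume.restrict (Ioi (0 : ℝ))).prod volume) →
      AEStronglyMeasurable (Function.uncurry v) ((volume.restrict (Ioi (0 : ℝ))).prod volume) →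
      ∀ m : ℝ≥0∞, m ≠ ⊤ → weightedSup u ≤ m → weightedSup v ≤ m → ∀ t : ℝ, 0 < t →
        ENNReal.ofReal (t ^ (1 / 4 : ℝ)) * norm43 (duhamelTerm u t - duhamelTerm v t)
          ≤ C * (m + m) * duhamelAverage
            (fun τ => ENNReal.ofReal (τ ^ (1 / 4 : ℝ)) * norm43 (u τ - v τ)) t := by
  obtain ⟨C, hC, hCb⟩ := exists_norm43_duhamelTerm_sub_le
  refine ⟨C, hC, fun u v hu hv m hm hum hvm t ht => ?_⟩
  have hmm : m + m ≠ ⊤ := ENNReal.add_ne_top.2 ⟨hm, hm⟩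
  have hI : ∫⁻ τ in Ioo 0 t, ENNReal.ofReal ((t - τ) ^ (-(3 / 4) : ℝ)) *
        (norm43 (u τ - v τ) * (norm43 (u τ) + norm43 (v τ)))
      ≤ (m + m) * ∫⁻ τ in Ioo 0 t, duhamelWeight t τ *
          (ENNReal.ofReal (τ ^ (1 / 4 : ℝ)) * norm43 (u τ - v τ)) := by
    rw [← lintegral_const_mul' _ _ hmm]
    refine setLIntegral_mono' measurableSet_Ioo fun τ hτ => ?_
    have h1 := ofReal_rpow_mul_ofReal_sq hτ.1
    have h2 := (le_weightedSup u hτ.1).trans hum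
    have h3 := (le_weightedSup v hτ.1).trans hvm
    set a := ENNReal.ofReal (τ ^ (1 / 4 : ℝ))
    set b := ENNReal.ofReal (τ ^ (-(1 / 2) : ℝ)) with hb
    set g := ENNReal.ofReal ((t - τ) ^ (-(3 / 4) : ℝ)) with hg
    calc g * (norm43 (u τ - v τ) * (norm43 (u τ) + norm43 (v τ)))
        = (b * (a * a)) * (g * (norm43 (u τ - v τ) * (norm43 (u τ) + norm43 (v τ)))) := by
          rw [h1, one_mul]
      _ = (a * norm43 (u τ) + a * norm43 (v τ)) * (g * b * (a * norm43 (u τ - v τ))) := by ring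
      _ ≤ (m + m) * (g * b * (a * norm43 (u τ - v τ))) := by gcongr
      _ = _ := by rw [duhamelWeight, ← hg, ← hb]
  calc _ ≤ ENNReal.ofReal (t ^ (1 / 4 : ℝ)) * (C * ((m + m) *
        ∫⁻ τ in Ioo 0 t, duhamelWeight t τ *
          (ENNReal.ofReal (τ ^ (1 / 4 : ℝ)) * norm43 (u τ - v τ)))) := by
        gcongr
        exact (hCb u v hu hv t ht).trans (by gcongr)
    _ = _ := by rw [duhamelAverage]; ring

/-! ### The limsup argument and the conclusion. -/

theorem tendsto_zero_of_limsup_le_zero {f : ℝ → ℝ≥0∞} (h : limsup f atTop ≤ 0) :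
    Tendsto f atTop (𝓝 0) :=
  tendsto_of_le_liminf_of_limsup_le zero_le h

/-- A bounded function dominated by a null function plus a small multiple of its own time average is
null at infinity. -/
theorem tendsto_zero_of_le_add_duhamelAverage {W H : ℝ → ℝ≥0∞} {M k : ℝ≥0∞} (hM : M ≠ ⊤)
    (hW : ∀ τ, 0 < τ → W τ ≤ M) (hk : k * 24 ≤ 1)
    (hWH : ∀ t, 0 < t → W t ≤ H t + k * duhamelAverage W t) (hH : Tendsto H atTop (𝓝 0)) :
    Tendsto W atTop (𝓝 0) := by
  refine tendsto_zero_of_limsup_le_zero ?_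
  set L := limsup W atTop with hL
  have hLt : L ≠ ⊤ := by
    refine ne_top_of_le_ne_top hM (limsup_le_of_le (by isBoundedDefault) ?_)
    filter_upwards [eventually_gt_atTop 0] with t ht using hW t ht
  have hA : limsup (duhamelAverage W) atTop ≤ 12 * L := limsup_duhamelAverage_le hM hW
  by_contra! hpos
  -- The slack from 12 to 18 gives an eventual strict bound; since `24 k ≤ 1`, the result is `L ≤
  -- L/8 + 3L/4`, impossible for `0 < L < ∞`.
  have hlt : 12 * L < 18 * L := ENNReal.mul_lt_mul_left hpos.ne' hLt (by norm_num)
  have hd : 0 < L / 8 := ENNReal.div_pos hpos.ne' (by simp)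
  have hle : L ≤ L / 8 + k * (18 * L) := by
    refine limsup_le_of_le (by isBoundedDefault) ?_
    filter_upwards [eventually_gt_atTop 0, eventually_lt_of_limsup_lt (hA.trans_lt hlt),
      hH.eventually_lt_const hd] with t ht hAt hHt
    calc W t ≤ H t + k * duhamelAverage W t := hWH t ht
      _ ≤ _ := by gcongr
  have hkt : k ≠ ⊤ := by
    rintro rfl
    simp at hk
  clear_value L
  lift L to NNReal using hLt
  lift k to NNReal using hkt
  have h8 : (L : ℝ≥0∞) / 8 = ((L / 8 : NNReal) : ℝ≥0∞) := by
    rw [ENNReal.coe_div (by norm_num)]; rfl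
  rw [h8] at hle
  norm_cast at hle hk hpos
  have hle' : (L : ℝ) ≤ L / 8 + k * (18 * L) := by exact_mod_cast hle
  have hk' : (k : ℝ) * 24 ≤ 1 := by exact_mod_cast hk
  have hp' : (0 : ℝ) < L := by exact_mod_cast hpos
  nlinarith

end DebyeNernstPlanck

open DebyeNernstPlanck
theorem mainTheorem4 :
    ∃ ε₀ : ℝ, 0 < ε₀ ∧ ∀ ε : ℝ, 0 < ε → ε ≤ ε₀ →
      ∀ u₀ v₀ : Tempered,
        besovNorm u₀ < ENNReal.ofReal ε → besovNorm v₀ < ENNReal.ofReal ε →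
      ∀ u v : ℝ → Plane → ℝ,
        IsMildSolution u₀ u → weightedSup u ≤ ENNReal.ofReal (2 * ε) →
        IsMildSolution v₀ v → weightedSup v ≤ ENNReal.ofReal (2 * ε) →
        (Tendsto (fun t : ℝ => ENNReal.ofReal (t ^ (1 / 4 : ℝ)) * norm43 (heat t (u₀ - v₀)))
            atTop (𝓝 0) ↔
          Tendsto (fun t : ℝ => ENNReal.ofReal (t ^ (1 / 4 : ℝ)) * norm43 (u t - v t))
            atTop (𝓝 0)) := by
  obtain ⟨C, hC, hCb⟩ := exists_weighted_duhamelTerm_sub_le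
  -- Here `k = C (2ε + 2ε)`, so `24 k = 96 C ε ≤ 1`; the added 1 allows for `C = 0`.
  refine ⟨1 / (96 * (C.toReal + 1)), by positivity, ?_⟩
  intro ε hε hεle u₀ v₀ _ _ u v hu hum hv hvm
  set m : ℝ≥0∞ := ENNReal.ofReal (2 * ε) with hm
  have hmt : m ≠ ⊤ := ENNReal.ofReal_ne_top
  set k : ℝ≥0∞ := C * (m + m) with hk
  have hk24 : k * 24 ≤ 1 := by
    have hCe : C = ENNReal.ofReal C.toReal := (ENNReal.ofReal_toReal hC).symm
    have hC0 : 0 ≤ C.toReal := ENNReal.toReal_nonneg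
    rw [hk, hCe, hm, ← ENNReal.ofReal_add (by positivity) (by positivity),
      ← ENNReal.ofReal_mul (by positivity), ← ENNReal.ofReal_ofNat 24,
      ← ENNReal.ofReal_mul (by positivity)]
    refine ENNReal.ofReal_le_one.2 ?_
    rw [le_div_iff₀ (by positivity)] at hεle
    nlinarith
  have hkt : k ≠ ⊤ := ENNReal.mul_ne_top hC (ENNReal.add_ne_top.2 ⟨hmt, hmt⟩)
  set W : ℝ → ℝ≥0∞ := fun t => ENNReal.ofReal (t ^ (1 / 4 : ℝ)) * norm43 (u t - v t) with hW
  have hWm : ∀ τ, 0 < τ → W τ ≤ m + m := by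
    intro τ hτ
    calc W τ ≤ ENNReal.ofReal (τ ^ (1 / 4 : ℝ)) * (norm43 (u τ) + norm43 (v τ)) := by
          simp only [hW]
          gcongr
          exact norm43_sub_le (hu.mem.memLp τ hτ).1 (hv.mem.memLp τ hτ).1
      _ ≤ m + m := by
          rw [mul_add]
          exact add_le_add ((le_weightedSup u hτ).trans hum) ((le_weightedSup v hτ).trans hvm)
  have hMt : m + m ≠ ⊤ := ENNReal.add_ne_top.2 ⟨hmt, hmt⟩
  have hD : ∀ t : ℝ, 0 < t → ENNReal.ofReal (t ^ (1 / 4 : ℝ)) *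
      norm43 (duhamelTerm u t - duhamelTerm v t) ≤ k * duhamelAverage W t :=
    hCb u v hu.mem.aestronglyMeasurable hv.mem.aestronglyMeasurable m hmt hum hvm
  constructor
  · intro hH
    refine tendsto_zero_of_le_add_duhamelAverage hMt hWm hk24 (fun t ht => ?_) hH
    calc W t ≤ ENNReal.ofReal (t ^ (1 / 4 : ℝ)) * (norm43 (heat t (u₀ - v₀))
          + norm43 (duhamelTerm u t - duhamelTerm v t)) := by
          simp only [hW]
          gcongr
          exact norm43_sub_le_heat_add hu hv ht
      _ ≤ _ := by
          rw [mul_add]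
          exact add_le_add le_rfl (hD t ht)
  · intro hW0
    -- In this direction no absorption is needed: the average of a bounded null function is null,
    -- and a finite `k` suffices.
    have hA : Tendsto (duhamelAverage W) atTop (𝓝 0) := by
      refine tendsto_zero_of_limsup_le_zero ((limsup_duhamelAverage_le hMt hWm).trans_eq ?_)
      rw [hW0.limsup_eq, mul_zero]
    have hsum : Tendsto (fun t => W t + k * duhamelAverage W t) atTop (𝓝 0) := by
      simpa using hW0.add (ENNReal.Tendsto.const_mul hA (Or.inr hkt))
    refine tendsto_of_tendsto_of_tendsto_of_le_of_le' tendsto_const_nhds hsum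
      (Eventually.of_forall fun _ => zero_le) ?_
    filter_upwards [eventually_gt_atTop 0] with t ht
    calc _ ≤ ENNReal.ofReal (t ^ (1 / 4 : ℝ)) * (norm43 (u t - v t)
          + norm43 (duhamelTerm u t - duhamelTerm v t)) := by
          gcongr
          exact norm43_heat_le_sub_add hu hv ht
      _ ≤ _ := by
          rw [mul_add]
          exact add_le_add le_rfl (hD t ht)
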